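/- There exist absolute constants $C_3, C_4 > 0$ such that the following holds for all integers $n \ge 2$ and $m$ with $m > C_3 n$ and $n > C_3 \log m$. Let $z, x \in \mathbb{C}^n$ be fixed vectors with $x^* z \neq 0$, and let $a_1, \dots, a_m \in \mathbb{C}^n$ be independent random vectors with distribution $CN(0, I)$, i.e. all coordinates are independent, and the real and imaginary parts of each coordinate are independent with law $N(0, 1/2)$. Let $A \in \mathbb{C}^{m \times n}$ be the matrix with rows $a_1^*, \dots, a_m^*$ and let $$T(x) = (A^* A)^{-1} \sum_{i=1}^m \frac{|a_i^* z|}{|a_i^* x|}\, a_i a_i^* x$$ be one step of alternating minimization (almost surely well defined). For a nonzero $y \in \mathbb{C}^n$ let $\theta(y) = \arcsin\frac{|y^* z|}{\|y\|\,\|z\|}$, the angle between $y$ and the hyperplane orthogonal to $z$, and for $\vartheta \in \mathbb{R}$ let $h(\vartheta) = \mathbb{E}\,|\alpha_1|\,|\alpha_1 \sin\vartheta + \alpha_2 \cos\vartheta|$, where $\alpha_1, \alpha_2$ are independent complex random variables with distribution $CN(0,1)$; the function $h$ is differentiable. Then, with probability at least $1 - 2/(\log n)^2$, $$\theta(T(x))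 > \left(1 - C_4 \frac{n}{\theta(x)\sqrt{m}}\right)\left(\theta(x) + \arctan\frac{h'(\theta(x))}{h(\theta(x))}\right).$$ -/

import Mathlib

open MeasureTheory ProbabilityTheory

namespace PhaseRetrieval

noncomputable section

/-- The complex normal distribution `CN(0, 1)` on `ℂ`: the real and the imaginary part are
independent with law `N(0, 1/2)`. -/
def complexNormal : Measure ℂ :=
  ((gaussianReal 0 (1 / 2)).prod (gaussianReal 0 (1 / 2))).map
    (fun p : ℝ × ℝ => (p.1 : ℂ) + (p.2 : ℂ) * Complex.I)

/-- The complex normal distribution `CN(0, I)` on `ℂⁿ`: the coordinates are independent with law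
`CN(0, 1)`. -/
def complexNormalVec (n : ℕ) : Measure (EuclideanSpace ℂ (Fin n)) :=
  (Measure.pi (fun _ : Fin n => complexNormal)).map (WithLp.toLp 2)

/-- The matrix `A` whose `i`-th row is `aᵢ*`. -/
def sensingMatrix {m n : ℕ} (a : Fin m → EuclideanSpace ℂ (Fin n)) : Matrix (Fin m) (Fin n) ℂ :=
  Matrix.of fun i j => star (a i j)

/-- `gVec z b x = (|b* z| / |b* x|) b b* x`, the contribution of one sensing vector `b`. -/
def gVec {n : ℕ} (z b x : EuclideanSpace ℂ (Fin n)) : EuclideanSpace ℂ (Fin n) :=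
  (((‖inner ℂ b z‖ / ‖inner ℂ b x‖ : ℝ) : ℂ) * inner ℂ b x) • b

/-- One step of alternating minimization,
`T(x) = (A* A)⁻¹ ∑ᵢ (|aᵢ* z| / |aᵢ* x|) aᵢ aᵢ* x`. -/
def altMinStep {m n : ℕ} (z : EuclideanSpace ℂ (Fin n)) (a : Fin m → EuclideanSpace ℂ (Fin n))
    (x : EuclideanSpace ℂ (Fin n)) : EuclideanSpace ℂ (Fin n) :=
  WithLp.toLp 2
    (((sensingMatrix a).conjTranspose * sensingMatrix a)⁻¹.mulVec
      (∑ i, gVec z (a i) x).ofLp)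

/-- `θ(x) = arcsin (|x* z| / (‖x‖ ‖z‖))`, the angle between `x` and the hyperplane orthogonal
to `z`. -/
def theta {n : ℕ} (z x : EuclideanSpace ℂ (Fin n)) : ℝ :=
  Real.arcsin (‖inner ℂ x z‖ / (‖x‖ * ‖z‖))

/-- `h(θ) = E |a₁| |a₁ sin θ + a₂ cos θ|` for independent `a₁, a₂ ∼ CN(0, 1)`. -/
def h (θ : ℝ) : ℝ :=
  ∫ p : ℂ × ℂ, ‖p.1‖ * ‖p.1 * (Real.sin θ : ℂ) + p.2 * (Real.cos θ : ℂ)‖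
    ∂(complexNormal.prod complexNormal)

/-! The integral that defines `h` exists and `h` is differentiable, so `h` and `deriv h` are the
intended functions. -/

instance : IsProbabilityMeasure complexNormal :=
  Measure.isProbabilityMeasure_map (by fun_prop)

instance (n : ℕ) : IsProbabilityMeasure (complexNormalVec n) :=
  Measure.isProbabilityMeasure_map (by fun_prop)

theorem complexNormal_singleton (w : ℂ) : complexNormal {w} = 0 := by
  have : NullSingletonClass (gaussianReal 0 (1 / 2)) :=
    nullSingletonClass_gaussianReal (by norm_num)
  rw [complexNormal, Measure.map_apply (by fun_prop) (measurableSet_singleton w)]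
  refine measure_mono_null (t := {(w.re, w.im)}) ?_
    (by rw [← Set.singleton_prod_singleton, Measure.prod_prod, measure_singleton, zero_mul])
  rintro ⟨p, q⟩ hp
  simp only [Set.mem_preimage, Set.mem_singleton_iff] at hp
  subst hp
  simp

theorem memLp_complexNormal : MemLp (fun w : ℂ => w) 2 complexNormal := by
  have hg : MemLp (fun t : ℝ => t) 2 (gaussianReal 0 (1 / 2)) :=
    memLp_id_gaussianReal 2
  have h1 := (hg.comp_fst (gaussianReal 0 (1 / 2))).ofReal (K := ℂ)
  have h2 := (hg.comp_snd (gaussianReal 0 (1 / 2))).ofReal (K := ℂ)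
  rw [complexNormal, memLp_map_measure_iff (by fun_prop) (by fun_prop)]
  exact h1.add (h2.mul_const Complex.I)

theorem integrable_bound :
    Integrable (fun p : ℂ × ℂ => ‖p.1‖ * (‖p.1‖ + ‖p.2‖))
      (complexNormal.prod complexNormal) := by
  have h1 := (memLp_complexNormal.comp_fst complexNormal).norm
  have h2 := (memLp_complexNormal.comp_snd complexNormal).norm
  exact h1.integrable_mul (h1.add h2)

theorem integrable_h (θ : ℝ) :
    Integrable (fun p : ℂ × ℂ => ‖p.1‖ * ‖p.1 * (Real.sin θ : ℂ) + p.2 * (Real.cos θ : ℂ)‖)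
      (complexNormal.prod complexNormal) := by
  refine integrable_bound.mono' (by fun_prop) (Filter.Eventually.of_forall fun p => ?_)
  rw [norm_mul, norm_norm, norm_norm]
  gcongr
  refine (norm_add_le _ _).trans ?_
  rw [norm_mul, norm_mul, Complex.norm_real, Complex.norm_real]
  gcongr
  · exact mul_le_of_le_one_right (norm_nonneg _) (Real.abs_sin_le_one θ)
  · exact mul_le_of_le_one_right (norm_nonneg _) (Real.abs_cos_le_one θ)

theorem ae_ne_zero (θ : ℝ) :
    ∀ᵐ p ∂(complexNormal.prod complexNormal),
      p.1 * (Real.sin θ : ℂ) + p.2 * (Real.cos θ : ℂ) ≠ 0 := by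
  have hm : MeasurableSet {p : ℂ × ℂ | p.1 * (Real.sin θ : ℂ) + p.2 * (Real.cos θ : ℂ) ≠ 0} :=
    (measurableSet_eq_fun (by fun_prop) (by fun_prop)).compl
  rw [Measure.ae_prod_iff_ae_ae hm]
  by_cases hc : Real.cos θ = 0
  · have hs : Real.sin θ ≠ 0 := by
      intro hs
      have := Real.sin_sq_add_cos_sq θ
      simp [hs, hc] at this
    have h0 : ∀ᵐ w ∂complexNormal, w ≠ 0 := by
      rw [ae_iff]; simpa using complexNormal_singleton 0
    filter_upwards [h0] with w hw
    refine Filter.Eventually.of_forall fun y => ?_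
    simp only [hc, Complex.ofReal_zero, mul_zero, add_zero]
    exact mul_ne_zero hw (by exact_mod_cast hs)
  · refine Filter.Eventually.of_forall fun w => ?_
    have hc' : (Real.cos θ : ℂ) ≠ 0 := by exact_mod_cast hc
    have h0 : ∀ᵐ y ∂complexNormal, y ≠ -(w * (Real.sin θ : ℂ)) / (Real.cos θ : ℂ) := by
      rw [ae_iff]; simpa using complexNormal_singleton (-(w * (Real.sin θ : ℂ)) / (Real.cos θ : ℂ))
    filter_upwards [h0] with y hy h1
    exact hy (by rw [eq_div_iff hc']; linear_combination h1)

theorem differentiable_h : Differentiable ℝ h := by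
  intro θ
  let w : ℝ → ℂ × ℂ → ℂ := fun t p => p.1 * (Real.sin t : ℂ) + p.2 * (Real.cos t : ℂ)
  let w' : ℝ → ℂ × ℂ → ℂ := fun t p => p.1 * (Real.cos t : ℂ) + p.2 * (-Real.sin t : ℂ)
  have hw : ∀ t p, HasDerivAt (fun s => w s p) (w' t p) t := fun t p =>
    ((Real.hasDerivAt_sin t).ofReal_comp.const_mul p.1).add
      (by simpa using (Real.hasDerivAt_cos t).ofReal_comp.const_mul p.2)
  refine (hasDerivAt_integral_of_dominated_loc_of_lip
    (μ := complexNormal.prod complexNormal) (s := Set.univ) (x₀ := θ)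
    (F := fun t p => ‖p.1‖ * ‖w t p‖)
    (F' := fun p => ‖p.1‖ * (inner ℝ (w θ p) (w' θ p) / ‖w θ p‖))
    (bound := fun p => ‖p.1‖ * (‖p.1‖ + ‖p.2‖)) Filter.univ_mem ?_
    (integrable_h θ) ?_ ?_ integrable_bound ?_).2.differentiableAt
  · exact Filter.Eventually.of_forall fun t => (integrable_h t).aestronglyMeasurable
  · apply Measurable.aestronglyMeasurable
    fun_prop
  · refine Filter.Eventually.of_forall fun p => ?_
    have hl : LipschitzWith (Real.nnabs (‖p.1‖ + ‖p.2‖)) (fun t => w t p) := by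
      refine lipschitzWith_of_nnnorm_deriv_le (fun t => (hw t p).differentiableAt) fun t => ?_
      rw [(hw t p).deriv, ← NNReal.coe_le_coe, coe_nnnorm, Real.coe_nnabs,
        abs_of_nonneg (by positivity)]
      refine (norm_add_le _ _).trans ?_
      rw [norm_mul, norm_mul, norm_neg, Complex.norm_real, Complex.norm_real]
      gcongr
      · exact mul_le_of_le_one_right (norm_nonneg _) (Real.abs_cos_le_one t)
      · exact mul_le_of_le_one_right (norm_nonneg _) (Real.abs_sin_le_one t)
    refine LipschitzWith.lipschitzOnWith (LipschitzWith.of_dist_le_mul fun s t => ?_)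
    have h1 := hl.dist_le_mul s t
    rw [Real.coe_nnabs, abs_of_nonneg (by positivity)] at h1 ⊢
    rw [Real.dist_eq, ← mul_sub, abs_mul, abs_norm, mul_assoc]
    gcongr
    exact (abs_norm_sub_norm_le _ _).trans (by rwa [← dist_eq_norm])
  · filter_upwards [ae_ne_zero θ] with p hp
    have h0 : w θ p ≠ 0 := hp
    have h1 := ((hw θ p).norm_sq).sqrt (by positivity)
    have h2 : HasDerivAt (fun s => ‖w s p‖) (inner ℝ (w θ p) (w' θ p) / ‖w θ p‖) θ := by
      convert h1 using 1
      · ext s; rw [Real.sqrt_sq (norm_nonneg _)]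
      · rw [Real.sqrt_sq (norm_nonneg _), mul_div_mul_left _ _ two_ne_zero]
    exact h2.const_mul _

end

end PhaseRetrieval

namespace PhaseRetrieval

section Invariance

open Complex in
theorem charFun_complexNormal (t : ℂ) :
    charFun complexNormal t = Complex.exp (-(‖t‖ ^ 2 / 4 : ℝ)) := by
  rw [charFun_apply, complexNormal, integral_map (by fun_prop) (by fun_prop)]
  have h1 : ∀ p : ℝ × ℝ, Complex.exp ((inner ℝ ((p.1 : ℂ) + (p.2 : ℂ) * Complex.I) t : ℝ) * I) =
      Complex.exp (t.re * p.1 * I) * Complex.exp (t.im * p.2 * I) := by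
    intro p
    rw [← Complex.exp_add]
    congr 1
    simp [Complex.inner]
    ring
  simp_rw [h1]
  rw [integral_prod_mul (fun x : ℝ => Complex.exp (t.re * x * I))
    (fun x : ℝ => Complex.exp (t.im * x * I)), ← charFun_apply_real, ← charFun_apply_real,
    charFun_gaussianReal, charFun_gaussianReal, ← Complex.exp_add]
  congr 1
  rw [← Complex.normSq_eq_norm_sq, Complex.normSq_apply]
  push_cast
  ring

theorem charFun_complexNormalVec {n : ℕ} (t : EuclideanSpace ℂ (Fin n)) :
    charFun (complexNormalVec n) t = Complex.exp (-(‖t‖ ^ 2 / 4 : ℝ)) := by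
  rw [charFun_apply, complexNormalVec, integral_map (by fun_prop) (by fun_prop)]
  have h1 : ∀ x : Fin n → ℂ, Complex.exp ((inner ℝ (WithLp.toLp 2 x) t : ℝ) * Complex.I) =
      ∏ i, Complex.exp ((inner ℝ (x i) (t i) : ℝ) * Complex.I) := by
    intro x
    rw [← Complex.exp_sum, ← Finset.sum_mul]
    congr 2
    simp [real_inner_eq_re_inner ℂ, PiLp.inner_apply]
  simp_rw [h1]
  rw [integral_fintype_prod_eq_prod
    (f := fun i (x : ℂ) => Complex.exp ((inner ℝ x (t i) : ℝ) * Complex.I))]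
  simp_rw [← charFun_apply, charFun_complexNormal, ← Complex.exp_sum]
  congr 1
  rw [EuclideanSpace.norm_sq_eq]
  push_cast
  rw [Finset.sum_div, Finset.sum_neg_distrib]

theorem inner_real_eq_re {n : ℕ} (x y : EuclideanSpace ℂ (Fin n)) :
    inner ℝ x y = (inner ℂ x y).re := by
  simp [PiLp.inner_apply, Complex.inner, mul_comm]

theorem measurePreserving_linearIsometryEquiv {n : ℕ}
    (U : EuclideanSpace ℂ (Fin n) ≃ₗᵢ[ℂ] EuclideanSpace ℂ (Fin n)) :
    MeasurePreserving U (complexNormalVec n) (complexNormalVec n) := by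
  have hU : Measurable U := U.continuous.measurable
  refine ⟨hU, ?_⟩
  have : IsProbabilityMeasure ((complexNormalVec n).map U) :=
    Measure.isProbabilityMeasure_map hU.aemeasurable
  refine Measure.ext_of_charFun (funext fun t => ?_)
  have h1 : ∀ x, inner ℝ (U x) t = inner ℝ x (U.symm t) := fun x => by
    rw [inner_real_eq_re, inner_real_eq_re, ← U.inner_map_map x, U.apply_symm_apply]
  rw [charFun_apply, integral_map hU.aemeasurable (by fun_prop)]
  simp_rw [h1]
  rw [← charFun_apply, charFun_complexNormalVec, charFun_complexNormalVec, U.symm.norm_map]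

theorem measurePreserving_eval_prod {ι E : Type*} [Fintype ι] [MeasurableSpace E]
    (μ : Measure E) [IsProbabilityMeasure μ] {i j : ι} (hij : i ≠ j) :
    MeasurePreserving (fun a : ι → E => (a i, a j)) (Measure.pi fun _ => μ) (μ.prod μ) := by
  refine ⟨by fun_prop, ?_⟩
  have h1 := (iIndepFun_pi (μ := fun _ : ι => μ) (X := fun _ => id)
    (fun _ => aemeasurable_id)).indepFun hij
  simp only [id] at h1
  rw [indepFun_iff_map_prod_eq_prod_map_map (measurable_pi_apply i).aemeasurable
    (measurable_pi_apply j).aemeasurable] at h1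
  have h2 := (measurePreserving_eval (fun _ : ι => μ) i).map_eq
  have h3 := (measurePreserving_eval (fun _ : ι => μ) j).map_eq
  rw [h1]
  exact congrArg₂ _ h2 h3

theorem measurePreserving_ofLp (n : ℕ) :
    MeasurePreserving (fun a : EuclideanSpace ℂ (Fin n) => a.ofLp) (complexNormalVec n)
      (Measure.pi fun _ => complexNormal) := by
  refine ⟨by fun_prop, ?_⟩
  rw [complexNormalVec, Measure.map_map (by fun_prop) (by fun_prop)]
  exact Measure.map_id

theorem measurePreserving_coord {n : ℕ} (i : Fin n) :
    MeasurePreserving (fun a : EuclideanSpace ℂ (Fin n) => a i) (complexNormalVec n)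
      complexNormal :=
  (measurePreserving_eval (fun _ : Fin n => complexNormal) i).comp (measurePreserving_ofLp n)

theorem exists_orthonormalBasis_pair {n : ℕ} (hn : 2 ≤ n) {x y : EuclideanSpace ℂ (Fin n)}
    (hx : ‖x‖ = 1) (hy : ‖y‖ = 1) (hxy : inner ℂ x y = 0) :
    ∃ b : OrthonormalBasis (Fin n) ℂ (EuclideanSpace ℂ (Fin n)),
      b ⟨0, by omega⟩ = x ∧ b ⟨1, by omega⟩ = y := by
  set i0 : Fin n := ⟨0, by omega⟩
  set i1 : Fin n := ⟨1, by omega⟩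
  have h01 : i0 ≠ i1 := by simp [i0, i1]
  let v : Fin n → EuclideanSpace ℂ (Fin n) := fun i => if i = i0 then x else y
  have hv0 : v i0 = x := by simp [v]
  have hv1 : v i1 = y := by simp [v, h01.symm]
  have hyx : inner ℂ y x = 0 := inner_eq_zero_symm.1 hxy
  have hv : Orthonormal ℂ (({i0, i1} : Set (Fin n)).domRestrict v) := by
    constructor
    · rintro ⟨i, hi⟩
      show ‖v i‖ = 1
      rcases hi with rfl | rfl
      · rw [hv0, hx]
      · rw [hv1, hy]
    · rintro ⟨i, hi⟩ ⟨j, hj⟩ h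
      have hne : i ≠ j := fun e => h (Subtype.ext e)
      show inner ℂ (v i) (v j) = 0
      rcases hi with rfl | rfl <;> rcases hj with rfl | rfl
      · exact absurd rfl hne
      · rw [hv0, hv1, hxy]
      · rw [hv0, hv1, hyx]
      · exact absurd rfl hne
  obtain ⟨b, hb⟩ := hv.exists_orthonormalBasis_extension_of_card_eq (by simp)
  exact ⟨b, (hb i0 (by simp)).trans hv0, (hb i1 (by simp)).trans hv1⟩

theorem exists_orthonormalBasis_single {n : ℕ} (hn : 2 ≤ n) {x : EuclideanSpace ℂ (Fin n)}
    (hx : ‖x‖ = 1) :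
    ∃ b : OrthonormalBasis (Fin n) ℂ (EuclideanSpace ℂ (Fin n)), b ⟨0, by omega⟩ = x := by
  set i0 : Fin n := ⟨0, by omega⟩
  have hv : Orthonormal ℂ (({i0} : Set (Fin n)).domRestrict fun _ => x) := by
    constructor
    · exact fun _ => hx
    · exact fun i j h => absurd (Subsingleton.elim i j) h
  obtain ⟨b, hb⟩ := hv.exists_orthonormalBasis_extension_of_card_eq (by simp)
  exact ⟨b, hb i0 (by simp)⟩

theorem measurePreserving_inner_pair {n : ℕ} (hn : 2 ≤ n) {x y : EuclideanSpace ℂ (Fin n)}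
    (hx : ‖x‖ = 1) (hy : ‖y‖ = 1) (hxy : inner ℂ x y = 0) :
    MeasurePreserving (fun a : EuclideanSpace ℂ (Fin n) => (inner ℂ x a, inner ℂ y a))
      (complexNormalVec n) (complexNormal.prod complexNormal) := by
  obtain ⟨b, rfl, rfl⟩ := exists_orthonormalBasis_pair hn hx hy hxy
  have h1 := ((measurePreserving_eval_prod complexNormal
    (show (⟨0, by omega⟩ : Fin n) ≠ ⟨1, by omega⟩ by simp)).comp (measurePreserving_ofLp n)).comp
      (measurePreserving_linearIsometryEquiv b.repr)
  convert h1 using 2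
  simp [b.repr_apply_apply]

theorem measurePreserving_inner {n : ℕ} (hn : 2 ≤ n) {x : EuclideanSpace ℂ (Fin n)}
    (hx : ‖x‖ = 1) :
    MeasurePreserving (fun a : EuclideanSpace ℂ (Fin n) => inner ℂ x a)
      (complexNormalVec n) complexNormal := by
  obtain ⟨b, rfl⟩ := exists_orthonormalBasis_single hn hx
  have h1 := (measurePreserving_coord ⟨0, by omega⟩).comp
      (measurePreserving_linearIsometryEquiv b.repr)
  convert h1 using 2
  simp [b.repr_apply_apply]

theorem measurePreserving_neg_complexNormal :
    MeasurePreserving (fun w : ℂ => -w) complexNormal complexNormal := by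
  refine ⟨by fun_prop, ?_⟩
  have : IsProbabilityMeasure (complexNormal.map fun w : ℂ => -w) :=
    Measure.isProbabilityMeasure_map (by fun_prop)
  refine Measure.ext_of_charFun (funext fun t => ?_)
  rw [charFun_apply, integral_map (by fun_prop) (by fun_prop)]
  simp_rw [inner_neg_left, ← inner_neg_right]
  rw [← charFun_apply, charFun_complexNormal, charFun_complexNormal, norm_neg]

theorem measurePreserving_conj_complexNormal :
    MeasurePreserving (fun w : ℂ => starRingEnd ℂ w) complexNormal complexNormal := by
  have hm : Measurable fun w : ℂ => starRingEnd ℂ w := Complex.continuous_conj.measurable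
  refine ⟨hm, ?_⟩
  have : IsProbabilityMeasure (complexNormal.map fun w : ℂ => starRingEnd ℂ w) :=
    Measure.isProbabilityMeasure_map hm.aemeasurable
  refine Measure.ext_of_charFun (funext fun t => ?_)
  rw [charFun_apply, integral_map hm.aemeasurable (by fun_prop)]
  have h1 : ∀ x : ℂ, inner ℝ (starRingEnd ℂ x) t = inner ℝ x (starRingEnd ℂ t) := fun x => by
    simp [Complex.inner]
  simp_rw [h1]
  rw [← charFun_apply, charFun_complexNormal, charFun_complexNormal, RCLike.norm_conj]

end Invariance

section MeanFunction

theorem hasDerivAt_h (θ : ℝ) :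
    Integrable (fun p : ℂ × ℂ => ‖p.1‖ *
      (inner ℝ (p.1 * (Real.sin θ : ℂ) + p.2 * (Real.cos θ : ℂ))
        (p.1 * (Real.cos θ : ℂ) + p.2 * (-Real.sin θ : ℂ)) /
        ‖p.1 * (Real.sin θ : ℂ) + p.2 * (Real.cos θ : ℂ)‖))
      (complexNormal.prod complexNormal) ∧
    HasDerivAt h (∫ p : ℂ × ℂ, ‖p.1‖ *
      (inner ℝ (p.1 * (Real.sin θ : ℂ) + p.2 * (Real.cos θ : ℂ))
        (p.1 * (Real.cos θ : ℂ) + p.2 * (-Real.sin θ : ℂ)) /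
        ‖p.1 * (Real.sin θ : ℂ) + p.2 * (Real.cos θ : ℂ)‖)
      ∂(complexNormal.prod complexNormal)) θ := by
  let w : ℝ → ℂ × ℂ → ℂ := fun t p => p.1 * (Real.sin t : ℂ) + p.2 * (Real.cos t : ℂ)
  let w' : ℝ → ℂ × ℂ → ℂ := fun t p => p.1 * (Real.cos t : ℂ) + p.2 * (-Real.sin t : ℂ)
  have hw : ∀ t p, HasDerivAt (fun s => w s p) (w' t p) t := fun t p =>
    ((Real.hasDerivAt_sin t).ofReal_comp.const_mul p.1).add
      (by simpa using (Real.hasDerivAt_cos t).ofReal_comp.const_mul p.2)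
  refine hasDerivAt_integral_of_dominated_loc_of_lip
    (μ := complexNormal.prod complexNormal) (s := Set.univ) (x₀ := θ)
    (F := fun t p => ‖p.1‖ * ‖w t p‖)
    (F' := fun p => ‖p.1‖ * (inner ℝ (w θ p) (w' θ p) / ‖w θ p‖))
    (bound := fun p => ‖p.1‖ * (‖p.1‖ + ‖p.2‖)) Filter.univ_mem ?_
    (integrable_h θ) ?_ ?_ integrable_bound ?_
  · exact Filter.Eventually.of_forall fun t => (integrable_h t).aestronglyMeasurable
  · apply Measurable.aestronglyMeasurable
    fun_prop
  · refine Filter.Eventually.of_forall fun p => ?_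
    have hl : LipschitzWith (Real.nnabs (‖p.1‖ + ‖p.2‖)) (fun t => w t p) := by
      refine lipschitzWith_of_nnnorm_deriv_le (fun t => (hw t p).differentiableAt) fun t => ?_
      rw [(hw t p).deriv, ← NNReal.coe_le_coe, coe_nnnorm, Real.coe_nnabs,
        abs_of_nonneg (by positivity)]
      refine (norm_add_le _ _).trans ?_
      rw [norm_mul, norm_mul, norm_neg, Complex.norm_real, Complex.norm_real]
      gcongr
      · exact mul_le_of_le_one_right (norm_nonneg _) (Real.abs_cos_le_one t)
      · exact mul_le_of_le_one_right (norm_nonneg _) (Real.abs_sin_le_one t)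
    refine LipschitzWith.lipschitzOnWith (LipschitzWith.of_dist_le_mul fun s t => ?_)
    have h1 := hl.dist_le_mul s t
    rw [Real.coe_nnabs, abs_of_nonneg (by positivity)] at h1 ⊢
    rw [Real.dist_eq, ← mul_sub, abs_mul, abs_norm, mul_assoc]
    gcongr
    exact (abs_norm_sub_norm_le _ _).trans (by rwa [← dist_eq_norm])
  · filter_upwards [ae_ne_zero θ] with p hp
    have h0 : w θ p ≠ 0 := hp
    have h1 := ((hw θ p).norm_sq).sqrt (by positivity)
    have h2 : HasDerivAt (fun s => ‖w s p‖) (inner ℝ (w θ p) (w' θ p) / ‖w θ p‖) θ := by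
      convert h1 using 1
      · ext s; rw [Real.sqrt_sq (norm_nonneg _)]
      · rw [Real.sqrt_sq (norm_nonneg _), mul_div_mul_left _ _ two_ne_zero]
    exact h2.const_mul _

theorem measurePreserving_rotate (θ : ℝ) :
    MeasurePreserving (fun p : ℂ × ℂ => (p.1 * (Real.sin θ : ℂ) + p.2 * (Real.cos θ : ℂ),
      p.1 * (Real.cos θ : ℂ) + p.2 * (-Real.sin θ : ℂ)))
      (complexNormal.prod complexNormal) (complexNormal.prod complexNormal) := by
  let e : Fin 2 → EuclideanSpace ℂ (Fin 2) := fun i => EuclideanSpace.single i 1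
  have he : Orthonormal ℂ e := EuclideanSpace.orthonormal_single
  have h0 := measurePreserving_inner_pair le_rfl (he.1 0) (he.1 1) (he.2 (by simp : (0 : Fin 2) ≠ 1))
  have hsc : (Real.sin θ : ℂ) * Real.sin θ + Real.cos θ * Real.cos θ = 1 := by
    exact_mod_cast (by nlinarith [Real.sin_sq_add_cos_sq θ] :
      Real.sin θ * Real.sin θ + Real.cos θ * Real.cos θ = 1)
  have i00 : inner ℂ (e 0) (e 0) = 1 := by simp [e]
  have i11 : inner ℂ (e 1) (e 1) = 1 := by simp [e]
  have i01 : inner ℂ (e 0) (e 1) = 0 := he.2 (by simp)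
  have i10 : inner ℂ (e 1) (e 0) = 0 := he.2 (by simp)
  have norm_one : ∀ u : EuclideanSpace ℂ (Fin 2), inner ℂ u u = 1 → ‖u‖ = 1 := by
    intro u hu
    have h2 := norm_sq_eq_re_inner (𝕜 := ℂ) u
    rw [hu, RCLike.one_re] at h2
    nlinarith [norm_nonneg u]
  have hz := measurePreserving_inner_pair le_rfl
    (x := (Real.sin θ : ℂ) • e 0 + (Real.cos θ : ℂ) • e 1)
    (y := (Real.cos θ : ℂ) • e 0 + (-Real.sin θ : ℂ) • e 1)
    (norm_one _ (by
      simp only [inner_add_left, inner_add_right, inner_smul_left, inner_smul_right, i00, i11, i01,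
        i10, Complex.conj_ofReal]
      linear_combination hsc))
    (norm_one _ (by
      simp only [inner_add_left, inner_add_right, inner_smul_left, inner_smul_right, i00, i11, i01,
        i10, Complex.conj_ofReal, map_neg]
      linear_combination hsc))
    (by
      simp only [inner_add_left, inner_add_right, inner_smul_left, inner_smul_right, i00, i11, i01,
        i10, Complex.conj_ofReal]
      ring)
  refine ⟨by fun_prop, ?_⟩
  rw [← h0.map_eq, Measure.map_map (by fun_prop) h0.measurable]
  conv_rhs => rw [h0.map_eq, ← hz.map_eq]
  refine congrArg (fun f => Measure.map f _) (funext fun a => Prod.ext ?_ ?_)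
  · simp only [Function.comp, inner_add_left, inner_smul_left, Complex.conj_ofReal]
    ring
  · simp only [Function.comp, inner_add_left, inner_smul_left, map_neg, Complex.conj_ofReal]
    ring

theorem sin_mul_sin_add_cos_mul_cos_coe (θ : ℝ) :
    (Real.sin θ : ℂ) * Real.sin θ + Real.cos θ * Real.cos θ = 1 := by
  exact_mod_cast (by nlinarith [Real.sin_sq_add_cos_sq θ] :
    Real.sin θ * Real.sin θ + Real.cos θ * Real.cos θ = 1)

theorem deriv_h_eq (θ : ℝ) :
    deriv h θ = ∫ p : ℂ × ℂ, ‖p.1 * (Real.sin θ : ℂ) + p.2 * (Real.cos θ : ℂ)‖ *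
      (inner ℝ p.1 p.2 / ‖p.1‖) ∂(complexNormal.prod complexNormal) := by
  rw [(hasDerivAt_h θ).2.deriv]
  conv_lhs => rw [← (measurePreserving_rotate θ).map_eq]
  rw [integral_map (measurePreserving_rotate θ).measurable.aemeasurable
    (by apply Measurable.aestronglyMeasurable; fun_prop)]
  refine integral_congr_ae (Filter.Eventually.of_forall fun p => ?_)
  have h1 : (p.1 * (Real.sin θ : ℂ) + p.2 * (Real.cos θ : ℂ)) * (Real.sin θ : ℂ) +
      (p.1 * (Real.cos θ : ℂ) + p.2 * (-Real.sin θ : ℂ)) * (Real.cos θ : ℂ) = p.1 := by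
    linear_combination p.1 * sin_mul_sin_add_cos_mul_cos_coe θ
  have h2 : (p.1 * (Real.sin θ : ℂ) + p.2 * (Real.cos θ : ℂ)) * (Real.cos θ : ℂ) +
      (p.1 * (Real.cos θ : ℂ) + p.2 * (-Real.sin θ : ℂ)) * (-Real.sin θ : ℂ) = p.2 := by
    linear_combination p.2 * sin_mul_sin_add_cos_mul_cos_coe θ
  show ‖_‖ * (inner ℝ (_ + _) (_ + _) / ‖_ + _‖) = _
  rw [h1, h2]

theorem measurePreserving_neg_snd :
    MeasurePreserving (fun p : ℂ × ℂ => (p.1, -p.2))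
      (complexNormal.prod complexNormal) (complexNormal.prod complexNormal) :=
  (MeasurePreserving.id complexNormal).prod measurePreserving_neg_complexNormal

theorem integral_nonneg_of_add_neg_snd_nonneg {f : ℂ × ℂ → ℝ}
    (hf : ∀ p : ℂ × ℂ, 0 ≤ f p + f (p.1, -p.2)) :
    0 ≤ ∫ p, f p ∂(complexNormal.prod complexNormal) := by
  by_cases hi : Integrable f (complexNormal.prod complexNormal)
  · have h1 : Integrable (fun p : ℂ × ℂ => f (p.1, -p.2)) (complexNormal.prod complexNormal) :=
      measurePreserving_neg_snd.integrable_comp_of_integrable hi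
    have h2 : ∫ p, f p ∂(complexNormal.prod complexNormal) =
        ∫ p, f (p.1, -p.2) ∂(complexNormal.prod complexNormal) := by
      conv_lhs => rw [← measurePreserving_neg_snd.map_eq]
      exact integral_map measurePreserving_neg_snd.measurable.aemeasurable
        (by rw [measurePreserving_neg_snd.map_eq]; exact hi.aestronglyMeasurable)
    have h3 := integral_nonneg (μ := complexNormal.prod complexNormal)
      (Pi.le_def.2 hf)
    rw [integral_add hi h1] at h3
    linarith
  · rw [integral_undef hi]

theorem deriv_h_nonneg {θ : ℝ} (hs : 0 ≤ Real.sin θ) (hc : 0 ≤ Real.cos θ) :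
    0 ≤ deriv h θ := by
  rw [deriv_h_eq]
  refine integral_nonneg_of_add_neg_snd_nonneg fun p => ?_
  set s := Real.sin θ
  set c := Real.cos θ
  simp only [inner_neg_right]
  have h1 : ‖p.1 * (s : ℂ) + p.2 * (c : ℂ)‖ ^ 2 - ‖p.1 * (s : ℂ) + -p.2 * (c : ℂ)‖ ^ 2 =
      4 * s * c * inner ℝ p.1 p.2 := by
    simp only [← Complex.normSq_eq_norm_sq, Complex.normSq_apply, Complex.inner]
    simp
    ring
  set A := ‖p.1 * (s : ℂ) + p.2 * (c : ℂ)‖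
  set B := ‖p.1 * (s : ℂ) + -p.2 * (c : ℂ)‖
  have hA : 0 ≤ A := norm_nonneg _
  have hB : 0 ≤ B := norm_nonneg _
  have h2 : 0 ≤ (A - B) * inner ℝ p.1 p.2 := by
    rcases le_total 0 (inner ℝ p.1 p.2) with h | h
    · refine mul_nonneg (sub_nonneg.2 (abs_le_of_sq_le_sq' ?_ hA).2) h
      have : 0 ≤ 4 * s * c * inner ℝ p.1 p.2 := by positivity
      linarith
    · refine mul_nonneg_of_nonpos_of_nonpos (sub_nonpos.2 (abs_le_of_sq_le_sq' ?_ hB).2) h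
      have : 4 * s * c * inner ℝ p.1 p.2 ≤ 0 := mul_nonpos_of_nonneg_of_nonpos (by positivity) h
      linarith
  have : A * (inner ℝ p.1 p.2 / ‖p.1‖) + B * (-inner ℝ p.1 p.2 / ‖p.1‖) =
      ((A - B) * inner ℝ p.1 p.2) / ‖p.1‖ := by ring
  rw [this]
  positivity

theorem inner_div_norm_sub_nonneg (u v : ℂ) :
    0 ≤ inner ℝ u (u - v) / ‖u‖ - inner ℝ v (u - v) / ‖v‖ := by
  have h1 : inner ℝ u v ≤ ‖u‖ * ‖v‖ := real_inner_le_norm u v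
  rw [inner_sub_right, inner_sub_right, real_inner_self_eq_norm_sq, real_inner_self_eq_norm_sq,
    real_inner_comm u v]
  rcases eq_or_ne u 0 with rfl | hu
  · simp only [norm_zero, div_zero, inner_zero_left, zero_sub, neg_div, sub_neg_eq_add, zero_add]
    positivity
  rcases eq_or_ne v 0 with rfl | hv
  · simp only [inner_zero_right, norm_zero, div_zero, sub_zero]; positivity
  have hu' : 0 < ‖u‖ := norm_pos_iff.2 hu
  have hv' : 0 < ‖v‖ := norm_pos_iff.2 hv
  have : (‖u‖ ^ 2 - inner ℝ u v) / ‖u‖ - (inner ℝ u v - ‖v‖ ^ 2) / ‖v‖ =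
      (‖u‖ + ‖v‖) * (‖u‖ * ‖v‖ - inner ℝ u v) / (‖u‖ * ‖v‖) := by
    field_simp; ring
  rw [this]
  have := sub_nonneg.2 h1
  positivity

theorem deriv_h_mul_sin_le {θ : ℝ} (hc : 0 ≤ Real.cos θ) :
    deriv h θ * Real.sin θ ≤ h θ * Real.cos θ := by
  obtain ⟨hi, hd⟩ := hasDerivAt_h θ
  rw [← sub_nonneg, hd.deriv, h, ← integral_mul_const, ← integral_mul_const,
    ← integral_sub ((integrable_h θ).mul_const _) (hi.mul_const _)]
  refine integral_nonneg_of_add_neg_snd_nonneg fun p => ?_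
  have hsc := sin_mul_sin_add_cos_mul_cos_coe θ
  set s := Real.sin θ
  set c := Real.cos θ
  have key : ∀ q : ℂ, ‖p.1‖ * ‖p.1 * (s : ℂ) + q * (c : ℂ)‖ * c - ‖p.1‖ *
      (inner ℝ (p.1 * (s : ℂ) + q * (c : ℂ)) (p.1 * (c : ℂ) + q * (-s : ℂ)) /
        ‖p.1 * (s : ℂ) + q * (c : ℂ)‖) * s =
      ‖p.1‖ * (inner ℝ (p.1 * (s : ℂ) + q * (c : ℂ)) q / ‖p.1 * (s : ℂ) + q * (c : ℂ)‖) := by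
    intro q
    set w := p.1 * (s : ℂ) + q * (c : ℂ)
    have hq : q = c • w - s • (p.1 * (c : ℂ) + q * (-s : ℂ)) := by
      simp only [Complex.real_smul, w]
      linear_combination (-q) * hsc
    conv_rhs => rw [hq, inner_sub_right, inner_smul_right, inner_smul_right,
      real_inner_self_eq_norm_sq]
    rcases eq_or_ne w 0 with hw | hw
    · simp [hw]
    · have := norm_pos_iff.2 hw
      field_simp
  rw [key, key, ← mul_add]
  refine mul_nonneg (norm_nonneg _) ?_
  rcases hc.eq_or_lt with h0 | h0
  · simp only [← h0, Complex.ofReal_zero, mul_zero, add_zero, inner_neg_right, neg_div]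
    exact (add_neg_cancel _).ge
  have h1 := inner_div_norm_sub_nonneg (p.1 * (s : ℂ) + p.2 * (c : ℂ))
    (p.1 * (s : ℂ) + -p.2 * (c : ℂ))
  have h2 : p.1 * (s : ℂ) + p.2 * (c : ℂ) - (p.1 * (s : ℂ) + -p.2 * (c : ℂ)) =
      (2 * c) • p.2 := by
    simp only [Complex.real_smul]; push_cast; ring
  rw [h2, inner_smul_right, inner_smul_right] at h1
  rw [inner_neg_right]
  have h3 : ∀ X Y A B : ℝ, 0 ≤ 2 * c * X / A - 2 * c * Y / B → 0 ≤ X / A + -Y / B := by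
    intro X Y A B h
    have h4 : 2 * c * X / A - 2 * c * Y / B = 2 * c * (X / A + -Y / B) := by ring
    rw [h4] at h
    exact nonneg_of_mul_nonneg_right h (by positivity)
  exact h3 _ _ _ _ h1

theorem memLp_id_complexNormal (p : NNReal) : MemLp (fun w : ℂ => w) p complexNormal := by
  have hg : MemLp (fun t : ℝ => t) p (gaussianReal 0 (1 / 2)) := memLp_id_gaussianReal p
  have h1 := (hg.comp_fst (gaussianReal 0 (1 / 2))).ofReal (K := ℂ)
  have h2 := (hg.comp_snd (gaussianReal 0 (1 / 2))).ofReal (K := ℂ)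
  rw [complexNormal, memLp_map_measure_iff (by fun_prop) (by fun_prop)]
  exact h1.add (h2.mul_const Complex.I)

theorem integrable_complexNormal_norm_pow (k : ℕ) :
    Integrable (fun w : ℂ => ‖w‖ ^ k) complexNormal :=
  (memLp_id_complexNormal k).integrable_norm_pow'

theorem integral_complexNormal_norm_sq : ∫ w : ℂ, ‖w‖ ^ 2 ∂complexNormal = 1 := by
  have h0 : ∫ t : ℝ, t ^ 2 ∂(gaussianReal 0 (1 / 2)) = 1 / 2 := by
    have h1 := variance_id_gaussianReal (μ := 0) (v := 1 / 2)
    rw [variance_eq_integral (by fun_prop)] at h1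
    simpa using h1
  have hi : Integrable (fun t : ℝ => t ^ 2) (gaussianReal 0 (1 / 2)) :=
    (memLp_id_gaussianReal 2).integrable_sq
  rw [complexNormal, integral_map (by fun_prop) (by fun_prop)]
  have h1 : ∀ p : ℝ × ℝ, ‖(p.1 : ℂ) + (p.2 : ℂ) * Complex.I‖ ^ 2 = p.1 ^ 2 + p.2 ^ 2 := by
    intro p
    rw [← Complex.normSq_eq_norm_sq, Complex.normSq_add_mul_I]
  simp_rw [h1]
  rw [integral_add (hi.comp_fst _) (hi.comp_snd _)]
  have e1 := integral_fun_fst (μ := gaussianReal 0 (1 / 2)) (ν := gaussianReal 0 (1 / 2))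
    (fun t : ℝ => t ^ 2)
  have e2 := integral_fun_snd (μ := gaussianReal 0 (1 / 2)) (ν := gaussianReal 0 (1 / 2))
    (fun t : ℝ => t ^ 2)
  rw [e1, e2, h0]
  norm_num

theorem integral_complexNormal_norm_pos : 0 < ∫ w : ℂ, ‖w‖ ∂complexNormal := by
  rw [integral_pos_iff_support_of_nonneg (fun _ => norm_nonneg _)
    (by simpa using integrable_complexNormal_norm_pow 1)]
  have : Function.support (fun w : ℂ => ‖w‖) = {0}ᶜ := by ext; simp
  rw [this, measure_compl (measurableSet_singleton 0) (measure_ne_top _ _),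
    complexNormal_singleton]
  simp

theorem exists_pos_le_h :
    ∃ κ : ℝ, 0 < κ ∧ ∀ θ : ℝ, 0 ≤ Real.sin θ → 0 ≤ Real.cos θ → κ ≤ h θ := by
  set m1 := ∫ w : ℂ, ‖w‖ ∂complexNormal
  have hm1 : 0 < m1 := integral_complexNormal_norm_pos
  refine ⟨min (1 / 2) (m1 * m1 / 2), by positivity, fun θ hs hc => ?_⟩
  have i1 : Integrable (fun w : ℂ => ‖w‖) complexNormal := by
    simpa using integrable_complexNormal_norm_pow 1
  have a1 : Real.sin θ ≤ h θ := by
    have hi : Integrable (fun p : ℂ × ℂ => Real.sin θ * ‖p.1‖ ^ 2)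
        (complexNormal.prod complexNormal) :=
      ((integrable_complexNormal_norm_pow 2).comp_fst _).const_mul _
    have e1 : ∫ p : ℂ × ℂ, Real.sin θ * ‖p.1‖ ^ 2 ∂(complexNormal.prod complexNormal) =
        Real.sin θ := by
      rw [integral_const_mul]
      have e1 := integral_fun_fst (μ := complexNormal) (ν := complexNormal)
        (fun w : ℂ => ‖w‖ ^ 2)
      rw [e1, integral_complexNormal_norm_sq]
      simp
    rw [← sub_nonneg]
    conv_rhs => rw [← e1, h]
    rw [← integral_sub (integrable_h θ) hi]
    refine integral_nonneg_of_add_neg_snd_nonneg fun p => ?_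
    have h1 := norm_add_le (p.1 * (Real.sin θ : ℂ) + p.2 * (Real.cos θ : ℂ))
      (p.1 * (Real.sin θ : ℂ) + -p.2 * (Real.cos θ : ℂ))
    have h2 : ‖p.1 * (Real.sin θ : ℂ) + p.2 * (Real.cos θ : ℂ) +
        (p.1 * (Real.sin θ : ℂ) + -p.2 * (Real.cos θ : ℂ))‖ = 2 * Real.sin θ * ‖p.1‖ := by
      rw [show p.1 * (Real.sin θ : ℂ) + p.2 * (Real.cos θ : ℂ) +
        (p.1 * (Real.sin θ : ℂ) + -p.2 * (Real.cos θ : ℂ)) =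
          ((2 * Real.sin θ : ℝ) : ℂ) * p.1 by push_cast; ring, norm_mul, Complex.norm_real,
        Real.norm_of_nonneg (by positivity)]
    rw [h2] at h1
    have h3 := mul_le_mul_of_nonneg_left h1 (norm_nonneg p.1)
    show 0 ≤ _ - _ + (_ - _)
    dsimp only
    nlinarith
  have a2 : Real.cos θ * (m1 * m1) ≤ h θ := by
    have hi : Integrable (fun p : ℂ × ℂ => Real.cos θ * (‖p.1‖ * ‖p.2‖))
        (complexNormal.prod complexNormal) :=
      (i1.mul_prod i1).const_mul _
    have e1 : ∫ p : ℂ × ℂ, Real.cos θ * (‖p.1‖ * ‖p.2‖) ∂(complexNormal.prod complexNormal) =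
        Real.cos θ * (m1 * m1) := by
      rw [integral_const_mul, integral_prod_mul (fun w : ℂ => ‖w‖) (fun w : ℂ => ‖w‖)]
    rw [← sub_nonneg]
    conv_rhs => rw [← e1, h]
    rw [← integral_sub (integrable_h θ) hi]
    refine integral_nonneg_of_add_neg_snd_nonneg fun p => ?_
    have h1 := norm_sub_le (p.1 * (Real.sin θ : ℂ) + p.2 * (Real.cos θ : ℂ))
      (p.1 * (Real.sin θ : ℂ) + -p.2 * (Real.cos θ : ℂ))
    have h2 : ‖p.1 * (Real.sin θ : ℂ) + p.2 * (Real.cos θ : ℂ) -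
        (p.1 * (Real.sin θ : ℂ) + -p.2 * (Real.cos θ : ℂ))‖ = 2 * Real.cos θ * ‖p.2‖ := by
      rw [show p.1 * (Real.sin θ : ℂ) + p.2 * (Real.cos θ : ℂ) -
        (p.1 * (Real.sin θ : ℂ) + -p.2 * (Real.cos θ : ℂ)) =
          ((2 * Real.cos θ : ℝ) : ℂ) * p.2 by push_cast; ring, norm_mul, Complex.norm_real,
        Real.norm_of_nonneg (by positivity)]
    rw [h2] at h1
    have h3 := mul_le_mul_of_nonneg_left h1 (norm_nonneg p.1)
    show 0 ≤ _ - _ + (_ - _)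
    dsimp only
    rw [norm_neg]
    nlinarith
  have h1 := Real.sin_sq_add_cos_sq θ
  by_cases h2 : 1 / 2 ≤ Real.sin θ
  · exact (min_le_left _ _).trans (h2.trans a1)
  · have h3 : 1 / 2 ≤ Real.cos θ := by
      push Not at h2
      nlinarith
    refine (min_le_right _ _).trans (le_trans ?_ a2)
    have := mul_pos hm1 hm1
    nlinarith

theorem abs_h_le (θ : ℝ) :
    |h θ| ≤ ∫ p : ℂ × ℂ, ‖p.1‖ * (‖p.1‖ + ‖p.2‖) ∂(complexNormal.prod complexNormal) := by
  rw [← Real.norm_eq_abs]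
  refine norm_integral_le_of_norm_le integrable_bound (Filter.Eventually.of_forall fun p => ?_)
  rw [norm_mul, norm_norm, norm_norm]
  gcongr
  refine (norm_add_le _ _).trans ?_
  rw [norm_mul, norm_mul, Complex.norm_real, Complex.norm_real]
  gcongr
  · exact mul_le_of_le_one_right (norm_nonneg _) (Real.abs_sin_le_one θ)
  · exact mul_le_of_le_one_right (norm_nonneg _) (Real.abs_cos_le_one θ)

theorem abs_deriv_h_le (θ : ℝ) :
    |deriv h θ| ≤ ∫ p : ℂ × ℂ, ‖p.1‖ * (‖p.1‖ + ‖p.2‖) ∂(complexNormal.prod complexNormal) := by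
  rw [(hasDerivAt_h θ).2.deriv]
  rw [← Real.norm_eq_abs]
  refine norm_integral_le_of_norm_le integrable_bound (Filter.Eventually.of_forall fun p => ?_)
  rw [norm_mul, norm_norm, norm_div, norm_norm]
  gcongr
  refine (div_le_of_le_mul₀ (norm_nonneg _) (norm_nonneg _)
    ((norm_inner_le_norm _ _).trans_eq (mul_comm _ _))).trans ?_
  refine (norm_add_le _ _).trans ?_
  rw [norm_mul, norm_mul, norm_neg, Complex.norm_real, Complex.norm_real]
  gcongr
  · exact mul_le_of_le_one_right (norm_nonneg _) (Real.abs_cos_le_one θ)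
  · exact mul_le_of_le_one_right (norm_nonneg _) (Real.abs_sin_le_one θ)

end MeanFunction

section Moments

variable {n : ℕ}

theorem memLp_id_complexNormalVec (p : NNReal) :
    MemLp (fun a : EuclideanSpace ℂ (Fin n) => a) p (complexNormalVec n) := by
  have h1 : ∀ i : Fin n, MemLp (fun a : EuclideanSpace ℂ (Fin n) => a i) p (complexNormalVec n) :=
    fun i => (memLp_id_complexNormal p).comp_measurePreserving (measurePreserving_coord i)
  have h2 := memLp_finsetSum (p := p) (μ := complexNormalVec n) Finset.univ
    (f := fun (i : Fin n) (a : EuclideanSpace ℂ (Fin n)) => ‖a i‖) (fun i _ => (h1 i).norm)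
  refine h2.mono (by fun_prop) (Filter.Eventually.of_forall fun a => ?_)
  rw [Real.norm_of_nonneg (Finset.sum_nonneg fun _ _ => norm_nonneg _)]
  have h3 : a = ∑ i, EuclideanSpace.single i (a i) := by
    ext j; simp [Finset.sum_apply, Pi.single_apply]
  conv_lhs => rw [h3]
  refine (norm_sum_le _ _).trans_eq (by simp)

theorem integrable_norm_pow_complexNormalVec (k : ℕ) :
    Integrable (fun a : EuclideanSpace ℂ (Fin n) => ‖a‖ ^ k) (complexNormalVec n) :=
  (memLp_id_complexNormalVec k).integrable_norm_pow'

theorem integral_coord_norm_pow (i : Fin n) (k : ℕ) :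
    ∫ a : EuclideanSpace ℂ (Fin n), ‖a i‖ ^ k ∂(complexNormalVec n) =
      ∫ w : ℂ, ‖w‖ ^ k ∂complexNormal := by
  rw [← (measurePreserving_coord i).map_eq,
    integral_map (measurePreserving_coord i).measurable.aemeasurable (by fun_prop)]

theorem integrable_coord_norm_pow (i : Fin n) (k : ℕ) :
    Integrable (fun a : EuclideanSpace ℂ (Fin n) => ‖a i‖ ^ k) (complexNormalVec n) :=
  (measurePreserving_coord i).integrable_comp_of_integrable (integrable_complexNormal_norm_pow k)

theorem integral_norm_sq_complexNormalVec :
    ∫ a : EuclideanSpace ℂ (Fin n), ‖a‖ ^ 2 ∂(complexNormalVec n) = n := by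
  simp_rw [EuclideanSpace.norm_sq_eq]
  rw [integral_finsetSum _ fun i _ => integrable_coord_norm_pow i 2]
  simp_rw [integral_coord_norm_pow, integral_complexNormal_norm_sq]
  simp

theorem integral_norm_pow_complexNormalVec_le (k : ℕ) :
    ∫ a : EuclideanSpace ℂ (Fin n), ‖a‖ ^ (2 * (k + 1)) ∂(complexNormalVec n) ≤
      n ^ (k + 1) * ∫ w : ℂ, ‖w‖ ^ (2 * (k + 1)) ∂complexNormal := by
  have h1 : ∀ a : EuclideanSpace ℂ (Fin n), ‖a‖ ^ (2 * (k + 1)) ≤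
      n ^ k * ∑ i, ‖a i‖ ^ (2 * (k + 1)) := by
    intro a
    have h2 := pow_sum_le_card_mul_sum_pow (s := Finset.univ) (f := fun i => ‖a i‖ ^ 2)
      (fun i _ => by positivity) k
    simp_rw [← pow_mul] at h2
    rw [pow_mul, EuclideanSpace.norm_sq_eq]
    simpa using h2
  refine (integral_mono (integrable_norm_pow_complexNormalVec _)
    ((integrable_finsetSum _ fun i _ => integrable_coord_norm_pow i _).const_mul _) h1).trans_eq ?_
  rw [integral_const_mul, integral_finsetSum _ fun i _ => integrable_coord_norm_pow i _]
  simp_rw [integral_coord_norm_pow]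
  simp
  ring

theorem integral_norm_inner_pow (hn : 2 ≤ n) (w : EuclideanSpace ℂ (Fin n)) {k : ℕ} (hk : k ≠ 0) :
    ∫ a : EuclideanSpace ℂ (Fin n), ‖(inner ℂ w a : ℂ)‖ ^ k ∂(complexNormalVec n) =
      ‖w‖ ^ k * ∫ w : ℂ, ‖w‖ ^ k ∂complexNormal := by
  rcases eq_or_ne w 0 with rfl | hw
  · simp [hk]
  have hw' : ‖w‖ ≠ 0 := norm_ne_zero_iff.2 hw
  have hu : ‖(((‖w‖⁻¹ : ℝ) : ℂ)) • w‖ = 1 := by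
    rw [norm_smul, Complex.norm_real, norm_inv, norm_norm, inv_mul_cancel₀ hw']
  have hmp := measurePreserving_inner hn hu
  rw [← hmp.map_eq, integral_map hmp.measurable.aemeasurable (by fun_prop), ← integral_const_mul]
  refine integral_congr_ae (Filter.Eventually.of_forall fun a => ?_)
  dsimp only
  rw [inner_smul_left, norm_mul, RCLike.norm_conj, Complex.norm_real, norm_inv, norm_norm,
    ← mul_pow, mul_inv_cancel_left₀ hw']

theorem integrable_norm_inner_pow (w : EuclideanSpace ℂ (Fin n)) (k : ℕ) :
    Integrable (fun a : EuclideanSpace ℂ (Fin n) => ‖(inner ℂ w a : ℂ)‖ ^ k)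
      (complexNormalVec n) := by
  refine ((integrable_norm_pow_complexNormalVec k).const_mul (‖w‖ ^ k)).mono' (by fun_prop)
    (Filter.Eventually.of_forall fun a => ?_)
  rw [norm_pow, norm_norm, ← mul_pow]
  gcongr
  exact norm_inner_le_norm w a

theorem integrable_norm_inner_sq_mul_norm_sq (w : EuclideanSpace ℂ (Fin n)) :
    Integrable (fun a : EuclideanSpace ℂ (Fin n) => ‖(inner ℂ w a : ℂ)‖ ^ 2 * ‖a‖ ^ 2)
      (complexNormalVec n) := by
  refine ((integrable_norm_pow_complexNormalVec 4).const_mul (‖w‖ ^ 2)).mono' (by fun_prop)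
    (Filter.Eventually.of_forall fun a => ?_)
  rw [Real.norm_of_nonneg (by positivity)]
  have := norm_inner_le_norm (𝕜 := ℂ) w a
  calc ‖(inner ℂ w a : ℂ)‖ ^ 2 * ‖a‖ ^ 2 ≤ (‖w‖ * ‖a‖) ^ 2 * ‖a‖ ^ 2 := by gcongr
    _ = _ := by ring

theorem integral_norm_inner_sq_mul_norm_sq_le (hn : 2 ≤ n) (w : EuclideanSpace ℂ (Fin n)) :
    ∫ a : EuclideanSpace ℂ (Fin n), ‖(inner ℂ w a : ℂ)‖ ^ 2 * ‖a‖ ^ 2 ∂(complexNormalVec n) ≤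
      n * ‖w‖ ^ 2 * ∫ w : ℂ, ‖w‖ ^ 4 ∂complexNormal := by
  rcases eq_or_ne w 0 with rfl | hw
  · simp
  have hw' : 0 < ‖w‖ := norm_pos_iff.2 hw
  have hn' : (0 : ℝ) < n := by positivity
  have h1 : ∀ a : EuclideanSpace ℂ (Fin n), ‖(inner ℂ w a : ℂ)‖ ^ 2 * ‖a‖ ^ 2 ≤
      n / (2 * ‖w‖ ^ 2) * ‖(inner ℂ w a : ℂ)‖ ^ 4 + ‖w‖ ^ 2 / (2 * n) * ‖a‖ ^ 4 := by
    intro a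
    have h2 : n / (2 * ‖w‖ ^ 2) * ‖(inner ℂ w a : ℂ)‖ ^ 4 + ‖w‖ ^ 2 / (2 * n) * ‖a‖ ^ 4 -
        ‖(inner ℂ w a : ℂ)‖ ^ 2 * ‖a‖ ^ 2 =
        (n * ‖(inner ℂ w a : ℂ)‖ ^ 2 - ‖w‖ ^ 2 * ‖a‖ ^ 2) ^ 2 / (2 * n * ‖w‖ ^ 2) := by
      field_simp; ring
    have h3 : 0 ≤ (n * ‖(inner ℂ w a : ℂ)‖ ^ 2 - ‖w‖ ^ 2 * ‖a‖ ^ 2) ^ 2 / (2 * n * ‖w‖ ^ 2) := by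
      positivity
    linarith
  have i1 := (integrable_norm_inner_pow w 4).const_mul (n / (2 * ‖w‖ ^ 2))
  have i2 := (integrable_norm_pow_complexNormalVec (n := n) 4).const_mul (‖w‖ ^ 2 / (2 * n))
  refine (integral_mono (integrable_norm_inner_sq_mul_norm_sq w) (i1.add i2) h1).trans ?_
  have h4 := integral_norm_pow_complexNormalVec_le (n := n) 1
  norm_num at h4
  have h5 : ∫ a : EuclideanSpace ℂ (Fin n), (n / (2 * ‖w‖ ^ 2) * ‖(inner ℂ w a : ℂ)‖ ^ 4 +
      ‖w‖ ^ 2 / (2 * n) * ‖a‖ ^ 4) ∂(complexNormalVec n) = _ := integral_add i1 i2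
  simp only [Pi.add_apply]
  rw [h5, integral_const_mul, integral_const_mul, integral_norm_inner_pow hn w four_ne_zero]
  calc _ ≤ n / (2 * ‖w‖ ^ 2) * (‖w‖ ^ 4 * ∫ w : ℂ, ‖w‖ ^ 4 ∂complexNormal) +
      ‖w‖ ^ 2 / (2 * n) * (n ^ 2 * ∫ w : ℂ, ‖w‖ ^ 4 ∂complexNormal) := by gcongr
    _ = _ := by field_simp; ring

theorem inner_integral_smul_eq_zero {f : EuclideanSpace ℂ (Fin n) → ℂ}
    {w : EuclideanSpace ℂ (Fin n)} (hf : ∀ a, f ((ℂ ∙ w)ᗮ.reflection a) = f a) :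
    inner ℂ w (∫ a, f a • a ∂(complexNormalVec n)) = 0 := by
  set U := (ℂ ∙ w)ᗮ.reflection
  set I := ∫ a, f a • a ∂(complexNormalVec n)
  have h1 : U I = I := by
    calc U I = ∫ a, U (f a • a) ∂(complexNormalVec n) :=
          (U.toContinuousLinearEquiv.integral_comp_comm _).symm
      _ = ∫ a, f (U a) • U a ∂(complexNormalVec n) := by simp_rw [map_smul, hf]
      _ = I := (measurePreserving_linearIsometryEquiv U).integral_comp
          U.toHomeomorph.measurableEmbedding fun a => f a • a
  have h2 : U w = -w := Submodule.reflection_orthogonalComplement_singleton_eq_neg w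
  have h3 := U.inner_map_map w I
  rw [h1, h2, inner_neg_left] at h3
  exact self_eq_neg.1 h3.symm

theorem inner_reflection_left {w x : EuclideanSpace ℂ (Fin n)} (hx : inner ℂ w x = 0)
    (a : EuclideanSpace ℂ (Fin n)) :
    inner ℂ ((ℂ ∙ w)ᗮ.reflection a) x = inner ℂ a x := by
  have h1 : (ℂ ∙ w)ᗮ.reflection x = x :=
    Submodule.reflection_mem_subspace_eq_self (Submodule.mem_orthogonal_singleton_iff_inner_right.2 hx)
  conv_lhs => rw [← h1]
  exact (ℂ ∙ w)ᗮ.reflection.inner_map_map a x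

theorem integrable_inner_smul (v : EuclideanSpace ℂ (Fin n)) :
    Integrable (fun a : EuclideanSpace ℂ (Fin n) => (inner ℂ a v : ℂ) • a) (complexNormalVec n) := by
  refine ((integrable_norm_pow_complexNormalVec 2).const_mul ‖v‖).mono' (by fun_prop)
    (Filter.Eventually.of_forall fun a => ?_)
  rw [norm_smul]
  have := norm_inner_le_norm (𝕜 := ℂ) a v
  nlinarith [norm_nonneg a]

theorem integral_inner_smul (hn : 2 ≤ n) (v : EuclideanSpace ℂ (Fin n)) :
    ∫ a : EuclideanSpace ℂ (Fin n), (inner ℂ a v : ℂ) • a ∂(complexNormalVec n) = v := by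
  set I := ∫ a : EuclideanSpace ℂ (Fin n), (inner ℂ a v : ℂ) • a ∂(complexNormalVec n)
  have h1 : inner ℂ v I = inner ℂ v v := by
    have h2 : ∀ a : EuclideanSpace ℂ (Fin n), inner ℂ v ((inner ℂ a v : ℂ) • a) =
        ((‖(inner ℂ v a : ℂ)‖ ^ 2 : ℝ) : ℂ) := by
      intro a
      rw [inner_smul_right, ← inner_conj_symm, ← Complex.normSq_eq_conj_mul_self,
        Complex.normSq_eq_norm_sq]
    rw [← integral_inner (integrable_inner_smul v)]
    simp_rw [h2]
    rw [integral_complex_ofReal, integral_norm_inner_pow hn v two_ne_zero, integral_complexNormal_norm_sq,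
      mul_one, inner_self_eq_norm_sq_to_K]
    push_cast
    rfl
  have h3 : inner ℂ v (I - v) = 0 := by rw [inner_sub_right, h1, sub_self]
  have h4 : inner ℂ (I - v) v = 0 := inner_eq_zero_symm.1 h3
  have h5 : inner ℂ (I - v) I = 0 :=
    inner_integral_smul_eq_zero fun a => inner_reflection_left h4 a
  have h6 : inner ℂ (I - v) (I - v) = 0 := by rw [inner_sub_right, h5, h4, sub_zero]
  exact sub_eq_zero.1 (inner_self_eq_zero.1 h6)

theorem div_mul_self_le_of_nonneg {a : ℝ} (ha : 0 ≤ a) (b : ℝ) : a / b * b ≤ a := by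
  rcases eq_or_ne b 0 with rfl | hb
  · simpa using ha
  · rw [div_mul_cancel₀ a hb]

theorem norm_gVec_le (z b x : EuclideanSpace ℂ (Fin n)) :
    ‖gVec z b x‖ ≤ ‖(inner ℂ z b : ℂ)‖ * ‖b‖ := by
  rw [gVec, norm_smul, norm_mul, Complex.norm_real, norm_div, norm_norm, norm_norm, norm_inner_symm]
  gcongr
  exact div_mul_self_le_of_nonneg (norm_nonneg _) _

theorem measurable_gVec (z x : EuclideanSpace ℂ (Fin n)) : Measurable fun b => gVec z b x := by
  unfold gVec
  fun_prop

theorem integrable_gVec (z x : EuclideanSpace ℂ (Fin n)) :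
    Integrable (fun b => gVec z b x) (complexNormalVec n) := by
  refine ((integrable_norm_pow_complexNormalVec 2).const_mul ‖z‖).mono'
    (measurable_gVec z x).aestronglyMeasurable (Filter.Eventually.of_forall fun a => ?_)
  refine (norm_gVec_le z a x).trans ?_
  have := norm_inner_le_norm (𝕜 := ℂ) z a
  nlinarith [norm_nonneg a]

theorem integral_conj_mul_div (θ : ℝ) :
    ∫ p : ℂ × ℂ, ((‖p.1 * (Real.sin θ : ℂ) + p.2 * (Real.cos θ : ℂ)‖ / ‖p.1‖ : ℝ) : ℂ) *
      (starRingEnd ℂ p.1 * p.2) ∂(complexNormal.prod complexNormal) = ((deriv h θ : ℝ) : ℂ) := by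
  set F : ℂ × ℂ → ℂ := fun p =>
    ((‖p.1 * (Real.sin θ : ℂ) + p.2 * (Real.cos θ : ℂ)‖ / ‖p.1‖ : ℝ) : ℂ) *
      (starRingEnd ℂ p.1 * p.2) with hF
  have hFm : Measurable F := by
    have := Complex.continuous_conj.measurable
    simp only [hF]
    refine Measurable.mul (by fun_prop) (Measurable.mul (this.comp measurable_fst) measurable_snd)
  have hFi : Integrable F (complexNormal.prod complexNormal) := by
    have hb : Integrable (fun p : ℂ × ℂ => ‖p.1‖ * ‖p.2‖ + ‖p.2‖ ^ 2)
        (complexNormal.prod complexNormal) := by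
      have i1 : Integrable (fun w : ℂ => ‖w‖) complexNormal := by
        simpa using integrable_complexNormal_norm_pow 1
      exact (i1.mul_prod i1).add ((integrable_complexNormal_norm_pow 2).comp_snd _)
    refine hb.mono' hFm.aestronglyMeasurable (Filter.Eventually.of_forall fun p => ?_)
    have h1 : ‖p.1 * (Real.sin θ : ℂ) + p.2 * (Real.cos θ : ℂ)‖ ≤ ‖p.1‖ + ‖p.2‖ := by
      refine (norm_add_le _ _).trans ?_
      rw [norm_mul, norm_mul, Complex.norm_real, Complex.norm_real]
      gcongr
      · exact mul_le_of_le_one_right (norm_nonneg _) (Real.abs_sin_le_one θ)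
      · exact mul_le_of_le_one_right (norm_nonneg _) (Real.abs_cos_le_one θ)
    simp only [hF, norm_mul, Complex.norm_real, norm_div, norm_norm, RCLike.norm_conj]
    have h2 : ‖p.1 * (Real.sin θ : ℂ) + p.2 * (Real.cos θ : ℂ)‖ / ‖p.1‖ * ‖p.1‖ ≤
        ‖p.1‖ + ‖p.2‖ :=
      (div_mul_self_le_of_nonneg (norm_nonneg _) _).trans h1
    rw [← mul_assoc]
    nlinarith [norm_nonneg p.2]
  have hmp := measurePreserving_conj_complexNormal.prod measurePreserving_conj_complexNormal
  have him : starRingEnd ℂ (∫ p, F p ∂(complexNormal.prod complexNormal)) =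
      ∫ p, F p ∂(complexNormal.prod complexNormal) := by
    rw [← integral_conj]
    conv_rhs => rw [← hmp.map_eq, integral_map hmp.measurable.aemeasurable
      hFm.aestronglyMeasurable]
    refine integral_congr_ae (Filter.Eventually.of_forall fun p => ?_)
    have h1 : ‖starRingEnd ℂ p.1 * (Real.sin θ : ℂ) + starRingEnd ℂ p.2 * (Real.cos θ : ℂ)‖ =
        ‖p.1 * (Real.sin θ : ℂ) + p.2 * (Real.cos θ : ℂ)‖ := by
      rw [← RCLike.norm_conj (p.1 * (Real.sin θ : ℂ) + p.2 * (Real.cos θ : ℂ)), map_add, map_mul,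
        map_mul, Complex.conj_ofReal, Complex.conj_ofReal]
    simp only [hF, Prod.map_fst, Prod.map_snd, h1, map_mul, Complex.conj_ofReal, RCLike.norm_conj]
  have hre : (∫ p, F p ∂(complexNormal.prod complexNormal)).re = deriv h θ := by
    rw [deriv_h_eq]
    have h1 := integral_re hFi
    rw [show (∫ p, F p ∂(complexNormal.prod complexNormal)).re =
      RCLike.re (∫ p, F p ∂(complexNormal.prod complexNormal)) from rfl, ← h1]
    refine integral_congr_ae (Filter.Eventually.of_forall fun p => ?_)
    show (F p).re = _
    simp only [hF, Complex.re_ofReal_mul, Complex.inner, mul_comm (starRingEnd ℂ p.1) p.2]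
    ring
  rw [← hre]
  exact (Complex.conj_eq_iff_re.1 him).symm

theorem integral_gVec (hn : 2 ≤ n) {x y : EuclideanSpace ℂ (Fin n)} (hx : ‖x‖ = 1) (hy : ‖y‖ = 1)
    (hxy : inner ℂ x y = 0) (θ : ℝ) :
    ∫ b, gVec ((Real.sin θ : ℂ) • x + (Real.cos θ : ℂ) • y) b x ∂(complexNormalVec n) =
      (h θ : ℂ) • x + ((deriv h θ : ℝ) : ℂ) • y := by
  set z := (Real.sin θ : ℂ) • x + (Real.cos θ : ℂ) • y with hz
  set v := (h θ : ℂ) • x + ((deriv h θ : ℝ) : ℂ) • y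
  set I := ∫ b, gVec z b x ∂(complexNormalVec n) with hI
  have hyx : inner ℂ y x = 0 := inner_eq_zero_symm.1 hxy
  have hxx : inner ℂ x x = (1 : ℂ) := by rw [inner_self_eq_norm_sq_to_K, hx]; simp
  have hyy : inner ℂ y y = (1 : ℂ) := by rw [inner_self_eq_norm_sq_to_K, hy]; simp
  have hmp := measurePreserving_inner_pair hn hx hy hxy
  have hza : ∀ a, ‖(inner ℂ a z : ℂ)‖ = ‖(inner ℂ x a : ℂ) * (Real.sin θ : ℂ) +
      (inner ℂ y a : ℂ) * (Real.cos θ : ℂ)‖ := by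
    intro a
    rw [norm_inner_symm, hz, inner_add_left, inner_smul_left, inner_smul_left, Complex.conj_ofReal,
      Complex.conj_ofReal, mul_comm, mul_comm (inner ℂ y a)]
  have hxI : inner ℂ x I = (h θ : ℂ) := by
    rw [hI, ← integral_inner (integrable_gVec z x), h, ← hmp.map_eq,
      integral_map hmp.measurable.aemeasurable (by fun_prop), ← integral_complex_ofReal]
    refine integral_congr_ae (Filter.Eventually.of_forall fun a => ?_)
    simp only [gVec]
    rw [inner_smul_right, hza a, mul_assoc, ← inner_conj_symm a x,
      ← Complex.normSq_eq_conj_mul_self, Complex.normSq_eq_norm_sq, RCLike.norm_conj,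
      ← Complex.ofReal_mul]
    congr 1
    rcases eq_or_ne ‖(inner ℂ x a : ℂ)‖ 0 with h0 | h0
    · rw [h0]; simp
    · field_simp
  have hyI : inner ℂ y I = ((deriv h θ : ℝ) : ℂ) := by
    rw [hI, ← integral_inner (integrable_gVec z x), ← integral_conj_mul_div, ← hmp.map_eq,
      integral_map hmp.measurable.aemeasurable]
    · refine integral_congr_ae (Filter.Eventually.of_forall fun a => ?_)
      simp only [gVec]
      rw [inner_smul_right, hza a, mul_assoc, ← inner_conj_symm a x, RCLike.norm_conj]
    · have := Complex.continuous_conj.measurable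
      exact (Measurable.mul (by fun_prop)
        (Measurable.mul (this.comp measurable_fst) measurable_snd)).aestronglyMeasurable
  have hxe : inner ℂ (I - v) x = 0 := by
    rw [← inner_eq_zero_symm, inner_sub_right, hxI, inner_add_right, inner_smul_right,
      inner_smul_right, hxx, hxy]
    ring
  have hye : inner ℂ (I - v) y = 0 := by
    rw [← inner_eq_zero_symm, inner_sub_right, hyI, inner_add_right, inner_smul_right,
      inner_smul_right, hyy, hyx]
    ring
  have hze : inner ℂ (I - v) z = 0 := by
    rw [hz, inner_add_right, inner_smul_right, inner_smul_right, hxe, hye]; ring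
  have hve : inner ℂ (I - v) v = 0 := by
    rw [inner_add_right, inner_smul_right, inner_smul_right, hxe, hye]; ring
  have h5 : inner ℂ (I - v) I = 0 := by
    refine inner_integral_smul_eq_zero (w := I - v) (f := fun b =>
      ((‖(inner ℂ b z : ℂ)‖ / ‖(inner ℂ b x : ℂ)‖ : ℝ) : ℂ) * inner ℂ b x) fun a => ?_
    simp only [inner_reflection_left hze, inner_reflection_left hxe]
  have h6 : inner ℂ (I - v) (I - v) = 0 := by rw [inner_sub_right, h5, hve, sub_zero]
  exact sub_eq_zero.1 (inner_self_eq_zero.1 h6)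

end Moments

section Geometry

theorem norm_sq_eq_norm_inner_sq_add {E : Type*} [NormedAddCommGroup E] [InnerProductSpace ℂ E]
    {z : E} (hz : ‖z‖ = 1) (u : E) :
    ‖u‖ ^ 2 = ‖(inner ℂ z u : ℂ)‖ ^ 2 + ‖u - (inner ℂ z u : ℂ) • z‖ ^ 2 := by
  have hzz : inner ℂ z z = (1 : ℂ) := by rw [inner_self_eq_norm_sq_to_K, hz]; simp
  have h1 : inner ℂ ((inner ℂ z u : ℂ) • z) (u - (inner ℂ z u : ℂ) • z) = 0 := by
    rw [inner_smul_left, inner_sub_right, inner_smul_right, hzz, mul_one, sub_self, mul_zero]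
  have h2 := norm_add_sq_eq_norm_sq_add_norm_sq_of_inner_eq_zero _ _ h1
  rw [add_sub_cancel, norm_smul, hz, mul_one] at h2
  nlinarith

theorem sub_theta_le {n : ℕ} {z T v : EuclideanSpace ℂ (Fin n)} {φ : ℝ} (hz : ‖z‖ = 1)
    (hφ : φ ∈ Set.Icc 0 (Real.pi / 2)) (hv : v ≠ 0) (hT : T ≠ 0)
    (hvφ : ‖(inner ℂ z v : ℂ)‖ = ‖v‖ * Real.sin φ) :
    φ - theta z T ≤ Real.pi / 2 * (‖T - v‖ / ‖T‖) := by
  set t := theta z T with ht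
  have hv0 : 0 < ‖v‖ := norm_pos_iff.2 hv
  have hT0 : 0 < ‖T‖ := norm_pos_iff.2 hT
  have hpi := Real.pi_pos
  rcases le_total φ t with h | h
  · exact (sub_nonpos.2 h).trans (by positivity)
  have hq0 : 0 ≤ ‖(inner ℂ T z : ℂ)‖ / (‖T‖ * ‖z‖) := by positivity
  have hq1 : ‖(inner ℂ T z : ℂ)‖ / (‖T‖ * ‖z‖) ≤ 1 :=
    div_le_one_of_le₀ (norm_inner_le_norm T z) (by positivity)
  have ht0 : 0 ≤ t := Real.arcsin_nonneg.2 hq0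
  have ht1 : t ≤ Real.pi / 2 := Real.arcsin_le_pi_div_two _
  have hsin : ‖(inner ℂ z T : ℂ)‖ = ‖T‖ * Real.sin t := by
    rw [ht, theta, Real.sin_arcsin (by linarith) hq1, hz, mul_one, mul_div_cancel₀ _ hT0.ne',
      norm_inner_symm]
  have hcos : ∀ (u : EuclideanSpace ℂ (Fin n)) (ψ : ℝ), 0 ≤ ψ → ψ ≤ Real.pi / 2 →
      ‖(inner ℂ z u : ℂ)‖ = ‖u‖ * Real.sin ψ →
      ‖u - (inner ℂ z u : ℂ) • z‖ = ‖u‖ * Real.cos ψ := by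
    intro u ψ h0 h1 h2
    have h3 := norm_sq_eq_norm_inner_sq_add hz u
    have h4 : 0 ≤ Real.cos ψ := Real.cos_nonneg_of_mem_Icc ⟨by linarith, h1⟩
    rw [← sq_eq_sq₀ (norm_nonneg _) (by positivity)]
    rw [h2] at h3
    have h5 := Real.sin_sq_add_cos_sq ψ
    have h6 : ‖u‖ ^ 2 * (Real.sin ψ ^ 2 + Real.cos ψ ^ 2) = ‖u‖ ^ 2 := by rw [h5, mul_one]
    linarith
  have hcT := hcos T t ht0 ht1 hsin
  have hcv := hcos v φ hφ.1 hφ.2 hvφ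
  have hsub := norm_sq_eq_norm_inner_sq_add hz (T - v)
  have hd1 : |‖(inner ℂ z T : ℂ)‖ - ‖(inner ℂ z v : ℂ)‖| ≤ ‖(inner ℂ z (T - v) : ℂ)‖ := by
    rw [inner_sub_right]; exact abs_norm_sub_norm_le _ _
  have hd2 : |‖T - (inner ℂ z T : ℂ) • z‖ - ‖v - (inner ℂ z v : ℂ) • z‖| ≤
      ‖T - v - (inner ℂ z (T - v) : ℂ) • z‖ := by
    refine (abs_norm_sub_norm_le _ _).trans_eq ?_
    rw [inner_sub_right, sub_smul]; congr 1; abel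
  rw [hsin, hvφ] at hd1
  rw [hcT, hcv] at hd2
  have hd1' := pow_le_pow_left₀ (abs_nonneg _) hd1 2
  have hd2' := pow_le_pow_left₀ (abs_nonneg _) hd2 2
  rw [sq_abs] at hd1' hd2'
  have key : ‖T‖ * Real.sin (φ - t) ≤ ‖T - v‖ := by
    refine abs_le_of_sq_le_sq' ?_ (norm_nonneg _) |>.2
    rw [Real.sin_sub]
    have e1 := Real.sin_sq_add_cos_sq φ
    have e2 : (‖T‖ * (Real.sin φ * Real.cos t - Real.cos φ * Real.sin t)) ^ 2 +
        (‖T‖ * (Real.sin φ * Real.sin t + Real.cos φ * Real.cos t) - ‖v‖) ^ 2 =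
        (‖T‖ * Real.sin t - ‖v‖ * Real.sin φ) ^ 2 + (‖T‖ * Real.cos t - ‖v‖ * Real.cos φ) ^ 2 := by
      have e3 := Real.sin_sq_add_cos_sq t
      linear_combination (‖T‖ ^ 2 * (Real.sin t ^ 2 + Real.cos t ^ 2) - ‖v‖ ^ 2) * e1
    nlinarith [sq_nonneg (‖T‖ * (Real.sin φ * Real.sin t + Real.cos φ * Real.cos t) - ‖v‖)]
  have hms := Real.mul_le_sin (sub_nonneg.2 h) (by linarith [hφ.2])
  have h7 : Real.sin (φ - t) ≤ ‖T - v‖ / ‖T‖ := by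
    rw [le_div_iff₀ hT0]; linarith
  have h8 : φ - t = Real.pi / 2 * (2 / Real.pi * (φ - t)) := by field_simp
  rw [h8]
  gcongr
  exact hms.trans h7

/-- The inner product of `a a* - 1` and `b b* - 1` in the space of `n × n` matrices. -/
noncomputable def frameKernel {n : ℕ} (a b : EuclideanSpace ℂ (Fin n)) : ℝ :=
  ‖(inner ℂ a b : ℂ)‖ ^ 2 - ‖a‖ ^ 2 - ‖b‖ ^ 2 + n

/-- The matrix `a a* - 1` as a vector. -/
noncomputable def rankOneSubOne {n : ℕ} (a : EuclideanSpace ℂ (Fin n)) :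
    EuclideanSpace ℂ (Fin n × Fin n) :=
  WithLp.toLp 2 fun p => a p.1 * starRingEnd ℂ (a p.2) - if p.1 = p.2 then 1 else 0

theorem inner_rankOneSubOne {n : ℕ} (a b : EuclideanSpace ℂ (Fin n)) :
    inner ℂ (rankOneSubOne a) (rankOneSubOne b) = (frameKernel a b : ℂ) := by
  have h1 : ∀ c : EuclideanSpace ℂ (Fin n),
      ((‖c‖ ^ 2 : ℝ) : ℂ) = ∑ j, starRingEnd ℂ (c j) * c j := by
    intro c
    rw [EuclideanSpace.norm_sq_eq, Complex.ofReal_sum]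
    refine Finset.sum_congr rfl fun j _ => ?_
    rw [← Complex.normSq_eq_norm_sq, Complex.normSq_eq_conj_mul_self]
  have h2 : ((‖(inner ℂ a b : ℂ)‖ ^ 2 : ℝ) : ℂ) =
      (∑ j, starRingEnd ℂ (a j) * b j) * ∑ k, a k * starRingEnd ℂ (b k) := by
    rw [← Complex.normSq_eq_norm_sq, ← Complex.mul_conj, PiLp.inner_apply, map_sum]
    congr 1
    · refine Finset.sum_congr rfl fun j _ => ?_
      rw [RCLike.inner_apply, mul_comm]
    · refine Finset.sum_congr rfl fun j _ => ?_
      rw [RCLike.inner_apply, map_mul, Complex.conj_conj, mul_comm]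
  have h3 : (frameKernel a b : ℂ) = ((‖(inner ℂ a b : ℂ)‖ ^ 2 : ℝ) : ℂ) - ((‖a‖ ^ 2 : ℝ) : ℂ) -
      ((‖b‖ ^ 2 : ℝ) : ℂ) + n := by
    rw [frameKernel]; push_cast; ring
  rw [h3, h2, h1, h1, PiLp.inner_apply, Fintype.sum_prod_type, Finset.sum_mul_sum,
    ← Finset.sum_sub_distrib, ← Finset.sum_sub_distrib]
  have h4 : (n : ℂ) = ∑ _j : Fin n, (1 : ℂ) := by simp
  rw [h4, ← Finset.sum_add_distrib]
  refine Finset.sum_congr rfl fun j _ => ?_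
  have h5 : ∀ k, inner ℂ ((rankOneSubOne a) (j, k)) ((rankOneSubOne b) (j, k)) =
      starRingEnd ℂ (a j) * b j * (a k * starRingEnd ℂ (b k)) -
        (if j = k then starRingEnd ℂ (a j) * a k else 0) -
        (if j = k then starRingEnd ℂ (b k) * b j else 0) + if j = k then 1 else 0 := by
    intro k
    simp only [rankOneSubOne, RCLike.inner_apply, map_sub, map_mul, Complex.conj_conj]
    split_ifs <;> simp <;> ring
  simp_rw [h5]
  rw [Finset.sum_add_distrib, Finset.sum_sub_distrib, Finset.sum_sub_distrib]
  simp

theorem norm_sq_sum_rankOneSubOne {n m : ℕ} (a : Fin m → EuclideanSpace ℂ (Fin n)) :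
    ‖∑ i, rankOneSubOne (a i)‖ ^ 2 = ∑ i, ∑ l, frameKernel (a i) (a l) := by
  rw [norm_sq_eq_re_inner (𝕜 := ℂ), sum_inner]
  simp_rw [inner_sum, inner_rankOneSubOne, map_sum]
  rfl

theorem norm_sum_inner_smul_sub_sq_le {n m : ℕ} (a : Fin m → EuclideanSpace ℂ (Fin n))
    (w : EuclideanSpace ℂ (Fin n)) :
    ‖∑ i, (inner ℂ (a i) w : ℂ) • a i - (m : ℂ) • w‖ ^ 2 ≤
      (∑ i, ∑ l, frameKernel (a i) (a l)) * ‖w‖ ^ 2 := by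
  rw [← norm_sq_sum_rankOneSubOne]
  set Y := ∑ i, rankOneSubOne (a i) with hY
  have h1 : ∀ j, (∑ i, (inner ℂ (a i) w : ℂ) • a i - (m : ℂ) • w) j = ∑ k, Y (j, k) * w k := by
    intro j
    have h2 : ∀ k, Y (j, k) = ∑ i, (a i j * starRingEnd ℂ (a i k) - if j = k then 1 else 0) := by
      intro k
      simp [hY, rankOneSubOne, WithLp.ofLp_sum]
    simp_rw [h2, Finset.sum_mul]
    rw [Finset.sum_comm]
    have h3 : ∀ i, ∑ k, (a i j * starRingEnd ℂ (a i k) - if j = k then 1 else 0) * w k =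
        (inner ℂ (a i) w : ℂ) * a i j - w j := by
      intro i
      simp_rw [sub_mul]
      rw [Finset.sum_sub_distrib, PiLp.inner_apply, Finset.sum_mul]
      congr 1
      · refine Finset.sum_congr rfl fun k _ => ?_
        rw [RCLike.inner_apply]; ring
      · simp
    simp_rw [h3]
    simp [WithLp.ofLp_sum]
  have h4 : ∀ j, ‖∑ k, Y (j, k) * w k‖ ^ 2 ≤ (∑ k, ‖Y (j, k)‖ ^ 2) * ‖w‖ ^ 2 := by
    intro j
    have h5 : ‖∑ k, Y (j, k) * w k‖ ≤ ∑ k, ‖Y (j, k)‖ * ‖w k‖ :=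
      (norm_sum_le _ _).trans_eq (by simp_rw [norm_mul])
    rw [EuclideanSpace.norm_sq_eq w]
    exact (pow_le_pow_left₀ (norm_nonneg _) h5 2).trans (Finset.sum_mul_sq_le_sq_mul_sq _ _ _)
  rw [EuclideanSpace.norm_sq_eq, EuclideanSpace.norm_sq_eq Y, Fintype.sum_prod_type, Finset.sum_mul]
  refine Finset.sum_le_sum fun j _ => ?_
  rw [h1]
  exact h4 j

theorem le_norm_sum_inner_smul {n m : ℕ} {a : Fin m → EuclideanSpace ℂ (Fin n)}
    (ha : ∑ i, ∑ l, frameKernel (a i) (a l) ≤ (m : ℝ) ^ 2 / 4) (w : EuclideanSpace ℂ (Fin n)) :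
    m / 2 * ‖w‖ ≤ ‖∑ i, (inner ℂ (a i) w : ℂ) • a i‖ := by
  have h1 := norm_sum_inner_smul_sub_sq_le a w
  have h2 : ‖∑ i, (inner ℂ (a i) w : ℂ) • a i - (m : ℂ) • w‖ ≤ m / 2 * ‖w‖ := by
    refine abs_le_of_sq_le_sq' ?_ (by positivity) |>.2
    nlinarith [mul_le_mul_of_nonneg_right ha (sq_nonneg ‖w‖)]
  have h3 := norm_sub_norm_le ((m : ℂ) • w) (∑ i, (inner ℂ (a i) w : ℂ) • a i)
  rw [norm_sub_rev, norm_smul, Complex.norm_natCast] at h3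
  linarith

theorem gram_mulVec {n m : ℕ} (a : Fin m → EuclideanSpace ℂ (Fin n))
    (w : EuclideanSpace ℂ (Fin n)) :
    WithLp.toLp 2 (((sensingMatrix a).conjTranspose * sensingMatrix a).mulVec w.ofLp) =
      ∑ i, (inner ℂ (a i) w : ℂ) • a i := by
  ext j
  rw [← Matrix.mulVec_mulVec]
  simp only [Matrix.mulVec, dotProduct, sensingMatrix, Matrix.conjTranspose_apply, Matrix.of_apply,
    star_star, WithLp.ofLp_sum, Finset.sum_apply, WithLp.ofLp_smul, Pi.smul_apply, smul_eq_mul,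
    PiLp.inner_apply, RCLike.inner_apply]
  refine Finset.sum_congr rfl fun i _ => ?_
  rw [mul_comm]
  congr 1
  exact Finset.sum_congr rfl fun k _ => mul_comm _ _

theorem norm_altMinStep_sub_le {n m : ℕ} (hm : 0 < m) {a : Fin m → EuclideanSpace ℂ (Fin n)}
    (ha : ∑ i, ∑ l, frameKernel (a i) (a l) ≤ (m : ℝ) ^ 2 / 4)
    (z x v : EuclideanSpace ℂ (Fin n)) :
    m / 2 * ‖altMinStep z a x - v‖ ≤ ‖∑ i, (gVec z (a i) x - (inner ℂ (a i) v : ℂ) • a i)‖ := by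
  set M := (sensingMatrix a).conjTranspose * sensingMatrix a with hM
  have hm' : (0 : ℝ) < m := by exact_mod_cast hm
  have hinj : Function.Injective M.mulVec := by
    intro u u' huu
    have h1 : ∑ i, (inner ℂ (a i) (WithLp.toLp 2 (u - u')) : ℂ) • a i = 0 := by
      rw [← gram_mulVec]
      show WithLp.toLp 2 (M.mulVec (u - u')) = 0
      rw [Matrix.mulVec_sub, huu, sub_self]; rfl
    have h2 := le_norm_sum_inner_smul ha (WithLp.toLp 2 (u - u'))
    rw [h1, norm_zero] at h2
    have h3 : ‖WithLp.toLp 2 (u - u')‖ = 0 :=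
      le_antisymm (nonpos_of_mul_nonpos_right h2 (by positivity)) (norm_nonneg _)
    have h4 := congrArg WithLp.ofLp (norm_eq_zero.1 h3)
    exact sub_eq_zero.1 h4
  have hunit := Matrix.mulVec_injective_iff_isUnit.1 hinj
  have hdet := (Matrix.isUnit_iff_isUnit_det M).1 hunit
  have hT : ∑ i, (inner ℂ (a i) (altMinStep z a x) : ℂ) • a i = ∑ i, gVec z (a i) x := by
    rw [← gram_mulVec, altMinStep, ← hM, Matrix.mulVec_mulVec, Matrix.mul_nonsing_inv M hdet,
      Matrix.one_mulVec]
  rw [Finset.sum_sub_distrib, ← hT, ← Finset.sum_sub_distrib]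
  simp_rw [← sub_smul, ← inner_sub_right]
  exact le_norm_sum_inner_smul ha _

end Geometry

section IndependentSums

variable {α : Type*} [MeasurableSpace α] {μ : Measure α} [IsProbabilityMeasure μ] {m : ℕ}

theorem memLp_eval_pair {k : α → α → ℝ} {p : ENNReal}
    (hk : MemLp (fun q : α × α => k q.1 q.2) p (μ.prod μ)) {i j : Fin m} (hij : i ≠ j) :
    MemLp (fun a : Fin m → α => k (a i) (a j)) p (Measure.pi fun _ => μ) :=
  hk.comp_measurePreserving (measurePreserving_eval_prod μ hij)

theorem integral_eval_pair {k : α → α → ℝ}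
    (hk : AEStronglyMeasurable (fun q : α × α => k q.1 q.2) (μ.prod μ)) {i j : Fin m}
    (hij : i ≠ j) :
    ∫ a : Fin m → α, k (a i) (a j) ∂(Measure.pi fun _ => μ) =
      ∫ q : α × α, k q.1 q.2 ∂(μ.prod μ) := by
  have hmp := measurePreserving_eval_prod μ hij
  rw [← hmp.map_eq, integral_map hmp.measurable.aemeasurable (by rwa [hmp.map_eq])]

theorem integral_eval {f : α → ℝ} (hf : AEStronglyMeasurable f μ) (i : Fin m) :
    ∫ a : Fin m → α, f (a i) ∂(Measure.pi fun _ => μ) = ∫ x, f x ∂μ := by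
  have hmp := measurePreserving_eval (fun _ : Fin m => μ) i
  conv_rhs => rw [← hmp.map_eq]
  rw [integral_map hmp.measurable.aemeasurable (by rwa [hmp.map_eq])]

theorem integral_norm_sq_sum_eval {H : Type*} [NormedAddCommGroup H] [InnerProductSpace ℂ H]
    [CompleteSpace H] {G : α → H} (hG : MemLp G 2 μ) (h0 : ∫ x, G x ∂μ = 0) :
    Integrable (fun a : Fin m → α => ‖∑ i, G (a i)‖ ^ 2) (Measure.pi fun _ => μ) ∧
    ∫ a : Fin m → α, ‖∑ i, G (a i)‖ ^ 2 ∂(Measure.pi fun _ => μ) = m * ∫ x, ‖G x‖ ^ 2 ∂μ := by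
  set q : α → α → ℝ := fun x y => RCLike.re (inner ℂ (G x) (G y))
  have hGe : ∀ i, MemLp (fun a : Fin m → α => G (a i)) 2 (Measure.pi fun _ => μ) :=
    fun i => hG.comp_measurePreserving (measurePreserving_eval (fun _ : Fin m => μ) i)
  have hG1 : Integrable G μ := hG.integrable one_le_two
  have hqi : ∀ i j, Integrable (fun a : Fin m → α => q (a i) (a j)) (Measure.pi fun _ => μ) := by
    intro i j
    refine ((hGe i).norm.integrable_mul (hGe j).norm).mono'
      (RCLike.continuous_re.comp_aestronglyMeasurable
        ((hGe i).aestronglyMeasurable.inner (hGe j).aestronglyMeasurable))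
      (Filter.Eventually.of_forall fun a => ?_)
    exact (RCLike.abs_re_le_norm _).trans (norm_inner_le_norm _ _)
  have hexp : ∀ a : Fin m → α, ‖∑ i, G (a i)‖ ^ 2 = ∑ i, ∑ j, q (a i) (a j) := by
    intro a
    rw [norm_sq_eq_re_inner (𝕜 := ℂ), sum_inner]
    simp_rw [inner_sum, map_sum]
    rfl
  have hqm : AEStronglyMeasurable (fun p : α × α => q p.1 p.2) (μ.prod μ) :=
    RCLike.continuous_re.comp_aestronglyMeasurable
      (hG1.aestronglyMeasurable.comp_fst.inner hG1.aestronglyMeasurable.comp_snd)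
  have hq : ∀ i j : Fin m, ∫ a : Fin m → α, q (a i) (a j) ∂(Measure.pi fun _ => μ) =
      if i = j then ∫ x, ‖G x‖ ^ 2 ∂μ else 0 := by
    intro i j
    split_ifs with hij
    · subst hij
      simp only [q, inner_self_eq_norm_sq]
      exact integral_eval (f := fun x => ‖G x‖ ^ 2) (hG.aestronglyMeasurable.norm.pow 2) i
    · rw [integral_eval_pair hqm hij]
      have hint : Integrable (fun p : α × α => q p.1 p.2) (μ.prod μ) := by
        refine (hG1.norm.mul_prod hG1.norm).mono' hqm (Filter.Eventually.of_forall fun p => ?_)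
        exact (RCLike.abs_re_le_norm _).trans (norm_inner_le_norm _ _)
      rw [integral_prod _ hint]
      refine integral_eq_zero_of_ae (Filter.Eventually.of_forall fun x => ?_)
      have h1 := integral_re (hG1.const_inner (𝕜 := ℂ) (G x))
      show ∫ y, RCLike.re (inner ℂ (G x) (G y)) ∂μ = 0
      rw [h1, integral_inner hG1, h0, inner_zero_right, map_zero]
  refine ⟨?_, ?_⟩
  · simp_rw [hexp]
    exact integrable_finsetSum _ fun i _ => integrable_finsetSum _ fun j _ => hqi i j
  · simp_rw [hexp]
    rw [integral_finsetSum _ fun i _ => integrable_finsetSum _ fun j _ => hqi i j]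
    simp_rw [fun i => integral_finsetSum Finset.univ fun j _ => hqi i j, hq]
    simp

theorem integral_kernel_mul_kernel_eq_zero {k : α → α → ℝ}
    (hk : Measurable fun q : α × α => k q.1 q.2) (h0 : ∀ y, ∫ x, k x y ∂μ = 0)
    {r o p q : Fin m} (ho : o ≠ r) (hp : p ≠ r) (hq : q ≠ r) :
    ∫ a : Fin m → α, k (a r) (a o) * k (a p) (a q) ∂(Measure.pi fun _ => μ) = 0 := by
  set P : Measure (Fin m → α) := Measure.pi fun _ => μ
  set T : Finset (Fin m) := Finset.univ.erase r with hT
  let R : (Fin m → α) → (T → α) := fun a i => a i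
  have hR : Measurable R := by fun_prop
  let o' : T := ⟨o, by simp [hT, ho]⟩
  let p' : T := ⟨p, by simp [hT, hp]⟩
  let q' : T := ⟨q, by simp [hT, hq]⟩
  have hind : IndepFun (fun a : Fin m → α => a r) R P := by
    have h1 := (iIndepFun_pi (μ := fun _ : Fin m => μ) (X := fun _ => id)
      (fun _ => aemeasurable_id)).indepFun_finset {r} T (by simp [hT])
        (fun i => measurable_pi_apply i)
    exact h1.comp (φ := fun f : (({r} : Finset (Fin m)) → α) => f ⟨r, by simp⟩) (ψ := id)
      (measurable_pi_apply _) measurable_id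
  have hmap := (indepFun_iff_map_prod_eq_prod_map_map (measurable_pi_apply r).aemeasurable
    hR.aemeasurable).1 hind
  have hr : P.map (fun a : Fin m → α => a r) = μ :=
    (measurePreserving_eval (fun _ : Fin m => μ) r).map_eq
  rw [hr] at hmap
  have : IsProbabilityMeasure (P.map R) := Measure.isProbabilityMeasure_map hR.aemeasurable
  let Φ : α × (T → α) → ℝ := fun s => k s.1 (s.2 o') * k (s.2 p') (s.2 q')
  have hΦ : Measurable Φ := by
    refine Measurable.mul (hk.comp (g := fun q : α × α => k q.1 q.2)
      (f := fun s : α × (T → α) => (s.1, s.2 o')) (by fun_prop)) ?_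
    exact hk.comp (g := fun q : α × α => k q.1 q.2)
      (f := fun s : α × (T → α) => (s.2 p', s.2 q')) (by fun_prop)
  have h2 : ∫ a, k (a r) (a o) * k (a p) (a q) ∂P = ∫ s, Φ s ∂(μ.prod (P.map R)) := by
    rw [← hmap, integral_map (by fun_prop) hΦ.aestronglyMeasurable]
  rw [h2]
  by_cases hi : Integrable Φ (μ.prod (P.map R))
  · rw [integral_prod_symm _ hi]
    refine integral_eq_zero_of_ae (Filter.Eventually.of_forall fun f => ?_)
    show ∫ x, k x (f o') * k (f p') (f q') ∂μ = 0
    rw [integral_mul_const, h0, zero_mul]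
  · exact integral_undef hi

theorem integral_sq_sum_offDiag_le {k : α → α → ℝ}
    (hk : Measurable fun q : α × α => k q.1 q.2) (hsymm : ∀ x y, k x y = k y x)
    (hk2 : MemLp (fun q : α × α => k q.1 q.2) 2 (μ.prod μ)) (h0 : ∀ y, ∫ x, k x y ∂μ = 0) :
    Integrable (fun a : Fin m → α => (∑ p ∈ Finset.univ.offDiag, k (a p.1) (a p.2)) ^ 2)
      (Measure.pi fun _ => μ) ∧
    ∫ a : Fin m → α, (∑ p ∈ Finset.univ.offDiag, k (a p.1) (a p.2)) ^ 2
      ∂(Measure.pi fun _ => μ) ≤ 2 * m ^ 2 * ∫ q : α × α, k q.1 q.2 ^ 2 ∂(μ.prod μ) := by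
  set κ := ∫ q : α × α, k q.1 q.2 ^ 2 ∂(μ.prod μ)
  have hκ : 0 ≤ κ := integral_nonneg fun _ => sq_nonneg _
  set D : Finset (Fin m × Fin m) := Finset.univ.offDiag with hD
  have hne : ∀ p ∈ D, p.1 ≠ p.2 := fun p hp => (Finset.mem_offDiag.1 hp).2.2
  have hL : ∀ p ∈ D, MemLp (fun a : Fin m → α => k (a p.1) (a p.2)) 2 (Measure.pi fun _ => μ) :=
    fun p hp => memLp_eval_pair hk2 (hne p hp)
  have hI : ∀ p ∈ D, ∀ q ∈ D, Integrable (fun a : Fin m → α =>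
      k (a p.1) (a p.2) * k (a q.1) (a q.2)) (Measure.pi fun _ => μ) :=
    fun p hp q hq => (hL p hp).integrable_mul (hL q hq)
  have hexp : ∀ a : Fin m → α, (∑ p ∈ D, k (a p.1) (a p.2)) ^ 2 =
      ∑ p ∈ D, ∑ q ∈ D, k (a p.1) (a p.2) * k (a q.1) (a q.2) := fun a => by
    rw [sq, Finset.sum_mul_sum]
  have hdiag : ∀ p ∈ D, ∫ a : Fin m → α, k (a p.1) (a p.2) * k (a p.1) (a p.2)
      ∂(Measure.pi fun _ => μ) = κ := by
    intro p hp
    simp_rw [← sq]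
    exact integral_eval_pair (k := fun x y => k x y ^ 2) (hk.pow_const 2).aestronglyMeasurable
      (hne p hp)
  have hterm : ∀ p ∈ D, ∀ q ∈ D, ∫ a : Fin m → α, k (a p.1) (a p.2) * k (a q.1) (a q.2)
      ∂(Measure.pi fun _ => μ) ≤ (if q = p then κ else 0) + (if q = p.swap then κ else 0) := by
    intro p hp q hq
    have hp' := hne p hp
    have hq' := hne q hq
    by_cases h1 : q = p
    · subst h1
      rw [hdiag q hq, if_pos rfl]
      split_ifs <;> linarith
    by_cases h2 : q = p.swap
    · subst h2
      rw [if_neg h1, if_pos rfl, zero_add]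
      simp only [Prod.fst_swap, Prod.snd_swap]
      refine le_of_eq ?_
      rw [← hdiag p hp]
      refine integral_congr_ae (Filter.Eventually.of_forall fun a => ?_)
      dsimp only
      rw [hsymm (a p.2) (a p.1)]
    rw [if_neg h1, if_neg h2, add_zero]
    refine le_of_eq ?_
    by_cases h3 : q.1 ≠ p.1 ∧ q.2 ≠ p.1
    · exact integral_kernel_mul_kernel_eq_zero hk h0 hp'.symm h3.1 h3.2
    by_cases h4 : q.1 ≠ p.2 ∧ q.2 ≠ p.2
    · simp_rw [fun a : Fin m → α => hsymm (a p.1) (a p.2)]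
      exact integral_kernel_mul_kernel_eq_zero hk h0 hp' h4.1 h4.2
    exfalso
    rcases p with ⟨i, l⟩
    rcases q with ⟨i', l'⟩
    simp only [Prod.swap_prod_mk, Prod.mk.injEq, ne_eq] at *
    grind
  refine ⟨?_, ?_⟩
  · simp_rw [hexp]
    exact integrable_finsetSum _ fun p hp => integrable_finsetSum _ fun q hq => hI p hp q hq
  · simp_rw [hexp]
    rw [integral_finsetSum _ fun p hp => integrable_finsetSum _ fun q hq => hI p hp q hq]
    have h5 : ∀ p ∈ D, ∫ a : Fin m → α, ∑ q ∈ D, k (a p.1) (a p.2) * k (a q.1) (a q.2)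
        ∂(Measure.pi fun _ => μ) ≤ 2 * κ := by
      intro p hp
      rw [integral_finsetSum _ fun q hq => hI p hp q hq]
      refine (Finset.sum_le_sum fun q hq => hterm p hp q hq).trans ?_
      rw [Finset.sum_add_distrib, Finset.sum_ite_eq', Finset.sum_ite_eq']
      split_ifs <;> linarith
    refine (Finset.sum_le_sum h5).trans ?_
    rw [Finset.sum_const, nsmul_eq_mul]
    have h6 : (D.card : ℝ) ≤ m ^ 2 := by
      have : D.card ≤ m ^ 2 := by
        rw [hD, Finset.offDiag_card, Finset.card_univ, Fintype.card_fin, sq]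
        exact Nat.sub_le _ _
      exact_mod_cast this
    nlinarith

theorem measureReal_le_sum_eval_le {f : α → ℝ} (hf : MemLp f 2 μ) {t : ℝ} (ht : 0 < t)
    (hmean : m * ∫ x, f x ∂μ ≤ t) :
    (Measure.pi fun _ : Fin m => μ).real {a | 2 * t ≤ ∑ i, f (a i)} ≤
      m * (∫ x, f x ^ 2 ∂μ) / t ^ 2 := by
  set P : Measure (Fin m → α) := Measure.pi fun _ => μ
  set X : (Fin m → α) → ℝ := ∑ i, fun a => f (a i) with hX
  have hfe : ∀ i, MemLp (fun a : Fin m → α => f (a i)) 2 P :=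
    fun i => hf.comp_measurePreserving (measurePreserving_eval (fun _ : Fin m => μ) i)
  have hXL : MemLp X 2 P := memLp_finsetSum' _ fun i _ => hfe i
  have hXmean : ∫ a, X a ∂P = m * ∫ x, f x ∂μ := by
    simp only [hX, Finset.sum_apply]
    rw [integral_finsetSum _ fun i _ => (hfe i).integrable one_le_two]
    simp_rw [P, fun i => integral_eval hf.aestronglyMeasurable i]
    simp
  have hvar : Var[X; P] ≤ m * ∫ x, f x ^ 2 ∂μ := by
    rw [hX, variance_sum_pi (fun _ => hf)]
    simp only [Finset.sum_const, Finset.card_univ, Fintype.card_fin, nsmul_eq_mul]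
    gcongr
    exact variance_le_expectation_sq hf.aestronglyMeasurable
  have h1 := meas_ge_le_variance_div_sq hXL ht
  have h2 : P.real {a | t ≤ |X a - ∫ a, X a ∂P|} ≤ Var[X; P] / t ^ 2 := by
    rw [measureReal_def]
    exact ENNReal.toReal_le_of_le_ofReal (div_nonneg (variance_nonneg _ _) (sq_nonneg _)) h1
  refine (measureReal_mono ?_).trans (h2.trans (by gcongr))
  intro a ha
  have h3 : X a = ∑ i, f (a i) := by simp [hX]
  show t ≤ |X a - ∫ a, X a ∂P|
  have h4 : 2 * t ≤ ∑ i, f (a i) := ha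
  rw [h3, hXmean]
  exact le_trans (by linarith) (le_abs_self _)

end IndependentSums

section Concentration

variable {n m : ℕ}

theorem frameKernel_comm (a b : EuclideanSpace ℂ (Fin n)) : frameKernel a b = frameKernel b a := by
  rw [frameKernel, frameKernel, norm_inner_symm]; ring

theorem measurable_frameKernel :
    Measurable fun q : EuclideanSpace ℂ (Fin n) × EuclideanSpace ℂ (Fin n) =>
      frameKernel q.1 q.2 := by
  unfold frameKernel
  fun_prop

theorem integral_frameKernel (hn : 2 ≤ n) (y : EuclideanSpace ℂ (Fin n)) :
    ∫ x, frameKernel x y ∂(complexNormalVec n) = 0 := by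
  have i1 := integrable_norm_inner_pow y 2
  have i2 := integrable_norm_pow_complexNormalVec (n := n) 2
  have h1 : ∀ x, frameKernel x y = ‖(inner ℂ y x : ℂ)‖ ^ 2 - ‖x‖ ^ 2 + (n - ‖y‖ ^ 2) := fun x => by
    rw [frameKernel, norm_inner_symm]; ring
  simp_rw [h1]
  have i3 : Integrable (fun x : EuclideanSpace ℂ (Fin n) => ‖(inner ℂ y x : ℂ)‖ ^ 2 - ‖x‖ ^ 2)
      (complexNormalVec n) := i1.sub i2
  rw [integral_add i3 (integrable_const _), integral_sub i1 i2, integral_norm_inner_pow hn y two_ne_zero, integral_complexNormal_norm_sq,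
    integral_norm_sq_complexNormalVec]
  simp

theorem frameKernel_sq_le (a b : EuclideanSpace ℂ (Fin n)) :
    frameKernel a b ^ 2 ≤
      4 * (‖(inner ℂ a b : ℂ)‖ ^ 4 + ‖a‖ ^ 4 + ‖b‖ ^ 4 + (n : ℝ) ^ 2) := by
  rw [frameKernel]
  set A := ‖(inner ℂ a b : ℂ)‖ ^ 2
  have hA : ‖(inner ℂ a b : ℂ)‖ ^ 4 = A ^ 2 := by ring
  have ha : ‖a‖ ^ 4 = (‖a‖ ^ 2) ^ 2 := by ring
  have hb : ‖b‖ ^ 4 = (‖b‖ ^ 2) ^ 2 := by ring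
  rw [hA, ha, hb]
  nlinarith [sq_nonneg (A + ‖a‖ ^ 2), sq_nonneg (A + ‖b‖ ^ 2), sq_nonneg (A - n),
    sq_nonneg (‖a‖ ^ 2 - ‖b‖ ^ 2), sq_nonneg (‖a‖ ^ 2 + n), sq_nonneg (‖b‖ ^ 2 + n)]

theorem integral_norm_pow_four_le :
    ∫ a : EuclideanSpace ℂ (Fin n), ‖a‖ ^ 4 ∂(complexNormalVec n) ≤
      n ^ 2 * ∫ w : ℂ, ‖w‖ ^ 4 ∂complexNormal :=
  integral_norm_pow_complexNormalVec_le 1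

theorem integral_norm_pow_eight_le :
    ∫ a : EuclideanSpace ℂ (Fin n), ‖a‖ ^ 8 ∂(complexNormalVec n) ≤
      n ^ 4 * ∫ w : ℂ, ‖w‖ ^ 8 ∂complexNormal :=
  integral_norm_pow_complexNormalVec_le 3

theorem integral_frameKernel_sq_le (hn : 2 ≤ n) :
    MemLp (fun q : EuclideanSpace ℂ (Fin n) × EuclideanSpace ℂ (Fin n) => frameKernel q.1 q.2) 2
      ((complexNormalVec n).prod (complexNormalVec n)) ∧
    ∫ q : EuclideanSpace ℂ (Fin n) × EuclideanSpace ℂ (Fin n), frameKernel q.1 q.2 ^ 2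
      ∂((complexNormalVec n).prod (complexNormalVec n)) ≤
      4 * n ^ 2 * ((∫ w : ℂ, ‖w‖ ^ 4 ∂complexNormal) + 1) ^ 2 := by
  set μ := complexNormalVec n
  set K := ∫ w : ℂ, ‖w‖ ^ 4 ∂complexNormal
  have hK : 0 ≤ K := integral_nonneg fun _ => by positivity
  have i4 : Integrable (fun a : EuclideanSpace ℂ (Fin n) => ‖a‖ ^ 4) μ :=
    integrable_norm_pow_complexNormalVec 4
  have j1 : Integrable (fun q : EuclideanSpace ℂ (Fin n) × EuclideanSpace ℂ (Fin n) =>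
      ‖(inner ℂ q.1 q.2 : ℂ)‖ ^ 4) (μ.prod μ) := by
    refine (i4.mul_prod i4).mono' (by fun_prop) (Filter.Eventually.of_forall fun q => ?_)
    rw [norm_pow, norm_norm, ← mul_pow]
    gcongr
    exact norm_inner_le_norm _ _
  have j2 : Integrable (fun q : EuclideanSpace ℂ (Fin n) × EuclideanSpace ℂ (Fin n) =>
      ‖q.1‖ ^ 4) (μ.prod μ) := i4.comp_fst μ
  have j3 : Integrable (fun q : EuclideanSpace ℂ (Fin n) × EuclideanSpace ℂ (Fin n) =>
      ‖q.2‖ ^ 4) (μ.prod μ) := i4.comp_snd μ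
  have j12 : Integrable (fun q : EuclideanSpace ℂ (Fin n) × EuclideanSpace ℂ (Fin n) =>
      ‖(inner ℂ q.1 q.2 : ℂ)‖ ^ 4 + ‖q.1‖ ^ 4) (μ.prod μ) := j1.add j2
  have j123 : Integrable (fun q : EuclideanSpace ℂ (Fin n) × EuclideanSpace ℂ (Fin n) =>
      ‖(inner ℂ q.1 q.2 : ℂ)‖ ^ 4 + ‖q.1‖ ^ 4 + ‖q.2‖ ^ 4) (μ.prod μ) := j12.add j3
  have j4 := (j123.add (integrable_const ((n : ℝ) ^ 2))).const_mul 4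
  have hm : AEStronglyMeasurable (fun q : EuclideanSpace ℂ (Fin n) × EuclideanSpace ℂ (Fin n) =>
      frameKernel q.1 q.2) (μ.prod μ) := measurable_frameKernel.aestronglyMeasurable
  have hi : Integrable (fun q : EuclideanSpace ℂ (Fin n) × EuclideanSpace ℂ (Fin n) =>
      frameKernel q.1 q.2 ^ 2) (μ.prod μ) := by
    refine j4.mono' (hm.pow 2) (Filter.Eventually.of_forall fun q => ?_)
    rw [Real.norm_of_nonneg (sq_nonneg _)]
    exact frameKernel_sq_le _ _
  refine ⟨(memLp_two_iff_integrable_sq hm).2 hi, ?_⟩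
  refine (integral_mono hi j4 fun q => frameKernel_sq_le _ _).trans ?_
  have e1 : ∫ q : EuclideanSpace ℂ (Fin n) × EuclideanSpace ℂ (Fin n),
      ‖(inner ℂ q.1 q.2 : ℂ)‖ ^ 4 ∂(μ.prod μ) ≤ n ^ 2 * K * K := by
    rw [integral_prod _ j1]
    simp_rw [μ, integral_norm_inner_pow hn _ four_ne_zero]
    rw [integral_mul_const]
    gcongr
    exact integral_norm_pow_four_le
  have e2 : ∫ q : EuclideanSpace ℂ (Fin n) × EuclideanSpace ℂ (Fin n), ‖q.1‖ ^ 4 ∂(μ.prod μ) ≤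
      n ^ 2 * K := by
    rw [integral_fun_fst (μ := μ) (ν := μ) fun a : EuclideanSpace ℂ (Fin n) => ‖a‖ ^ 4]
    simpa using integral_norm_pow_four_le
  have e3 : ∫ q : EuclideanSpace ℂ (Fin n) × EuclideanSpace ℂ (Fin n), ‖q.2‖ ^ 4 ∂(μ.prod μ) ≤
      n ^ 2 * K := by
    rw [integral_fun_snd (μ := μ) (ν := μ) fun a : EuclideanSpace ℂ (Fin n) => ‖a‖ ^ 4]
    simpa using integral_norm_pow_four_le
  rw [integral_const_mul]
  simp only [Pi.add_apply]
  have e4 : ∫ q : EuclideanSpace ℂ (Fin n) × EuclideanSpace ℂ (Fin n),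
      (‖(inner ℂ q.1 q.2 : ℂ)‖ ^ 4 + ‖q.1‖ ^ 4 + ‖q.2‖ ^ 4 + (n : ℝ) ^ 2) ∂(μ.prod μ) =
      ∫ q : EuclideanSpace ℂ (Fin n) × EuclideanSpace ℂ (Fin n),
        ‖(inner ℂ q.1 q.2 : ℂ)‖ ^ 4 ∂(μ.prod μ) +
      ∫ q : EuclideanSpace ℂ (Fin n) × EuclideanSpace ℂ (Fin n), ‖q.1‖ ^ 4 ∂(μ.prod μ) +
      ∫ q : EuclideanSpace ℂ (Fin n) × EuclideanSpace ℂ (Fin n), ‖q.2‖ ^ 4 ∂(μ.prod μ) +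
      (n : ℝ) ^ 2 := by
    rw [integral_add j123 (integrable_const _), integral_add j12 j3, integral_add j1 j2]
    simp
  rw [e4]
  nlinarith

theorem frameKernel_self (a : EuclideanSpace ℂ (Fin n)) :
    frameKernel a a = ‖a‖ ^ 4 - 2 * ‖a‖ ^ 2 + n := by
  rw [frameKernel, inner_self_eq_norm_sq_to_K, norm_pow, RCLike.norm_ofReal, abs_norm]
  ring

theorem integral_frameKernel_self_le (hn : 2 ≤ n) :
    MemLp (fun a : EuclideanSpace ℂ (Fin n) => frameKernel a a) 2 (complexNormalVec n) ∧
    ∫ a, frameKernel a a ∂(complexNormalVec n) ≤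
      n ^ 2 * ((∫ w : ℂ, ‖w‖ ^ 4 ∂complexNormal) + 1) ∧
    ∫ a, frameKernel a a ^ 2 ∂(complexNormalVec n) ≤
      2 * n ^ 4 * ((∫ w : ℂ, ‖w‖ ^ 8 ∂complexNormal) + 1) := by
  set μ := complexNormalVec n
  have hn1 : (1 : ℝ) ≤ n := by exact_mod_cast (by omega : 1 ≤ n)
  have hn2 : (n : ℝ) ≤ n ^ 2 := by nlinarith
  have i4 : Integrable (fun a : EuclideanSpace ℂ (Fin n) => ‖a‖ ^ 4) μ :=
    integrable_norm_pow_complexNormalVec 4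
  have i8 : Integrable (fun a : EuclideanSpace ℂ (Fin n) => ‖a‖ ^ 8) μ :=
    integrable_norm_pow_complexNormalVec 8
  have hm : AEStronglyMeasurable (fun a : EuclideanSpace ℂ (Fin n) => frameKernel a a) μ := by
    simp_rw [frameKernel_self]; fun_prop
  have hle : ∀ a : EuclideanSpace ℂ (Fin n), frameKernel a a ≤ ‖a‖ ^ 4 + n := fun a => by
    rw [frameKernel_self]; nlinarith [sq_nonneg ‖a‖]
  have hnn : ∀ a : EuclideanSpace ℂ (Fin n), 0 ≤ frameKernel a a := fun a => by
    rw [frameKernel_self]; nlinarith [sq_nonneg (‖a‖ ^ 2 - 1)]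
  have hsq : ∀ a : EuclideanSpace ℂ (Fin n), frameKernel a a ^ 2 ≤
      2 * ‖a‖ ^ 8 + 2 * (n : ℝ) ^ 2 := fun a => by
    have h1 := pow_le_pow_left₀ (hnn a) (hle a) 2
    nlinarith [sq_nonneg (‖a‖ ^ 4 - n)]
  have j8 := (i8.const_mul 2).add (integrable_const (2 * (n : ℝ) ^ 2))
  have hi2 : Integrable (fun a : EuclideanSpace ℂ (Fin n) => frameKernel a a ^ 2) μ := by
    refine j8.mono' (hm.pow 2) (Filter.Eventually.of_forall fun a => ?_)
    rw [Real.norm_of_nonneg (sq_nonneg _)]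
    exact hsq a
  have hL := (memLp_two_iff_integrable_sq hm).2 hi2
  refine ⟨hL, ?_, ?_⟩
  · refine (integral_mono (hL.integrable one_le_two) (i4.add (integrable_const (n : ℝ)))
      hle).trans ?_
    have e : ∫ a : EuclideanSpace ℂ (Fin n), (‖a‖ ^ 4 + (n : ℝ)) ∂μ =
        ∫ a : EuclideanSpace ℂ (Fin n), ‖a‖ ^ 4 ∂μ + n := by
      rw [integral_add i4 (integrable_const _)]; simp
    simp only [Pi.add_apply]
    rw [e]
    have := integral_norm_pow_four_le (n := n)
    linarith
  · refine (integral_mono hi2 j8 hsq).trans ?_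
    have e : ∫ a : EuclideanSpace ℂ (Fin n), (2 * ‖a‖ ^ 8 + 2 * (n : ℝ) ^ 2) ∂μ =
        2 * ∫ a : EuclideanSpace ℂ (Fin n), ‖a‖ ^ 8 ∂μ + 2 * (n : ℝ) ^ 2 := by
      rw [integral_add (i8.const_mul 2) (integrable_const _), integral_const_mul]; simp
    simp only [Pi.add_apply]
    rw [e]
    have := integral_norm_pow_eight_le (n := n)
    nlinarith

theorem sum_sum_eq_sum_add_sum_offDiag {ι : Type*} [Fintype ι] [DecidableEq ι] (f : ι → ι → ℝ) :
    ∑ i, ∑ j, f i j = ∑ i, f i i + ∑ p ∈ (Finset.univ : Finset ι).offDiag, f p.1 p.2 := by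
  rw [← Finset.sum_product', ← Finset.diag_union_offDiag,
    Finset.sum_union (Finset.disjoint_diag_offDiag _), Finset.sum_diag]

theorem measureReal_frame_not_tight_le (hn : 2 ≤ n) (hm : 0 < m)
    (hmn : 16 * ((∫ w : ℂ, ‖w‖ ^ 4 ∂complexNormal) + 1) * (n : ℝ) ^ 2 ≤ m) :
    (Measure.pi fun _ : Fin m => complexNormalVec n).real
      {a | (m : ℝ) ^ 2 / 4 < ∑ i, ∑ l, frameKernel (a i) (a l)} ≤
      512 * ((∫ w : ℂ, ‖w‖ ^ 4 ∂complexNormal) + 1) ^ 2 * (n : ℝ) ^ 2 / (m : ℝ) ^ 2 +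
      512 * ((∫ w : ℂ, ‖w‖ ^ 8 ∂complexNormal) + 1) * (n : ℝ) ^ 4 / (m : ℝ) ^ 3 := by
  set P := Measure.pi fun _ : Fin m => complexNormalVec n
  set K4 := ∫ w : ℂ, ‖w‖ ^ 4 ∂complexNormal
  set K8 := ∫ w : ℂ, ‖w‖ ^ 8 ∂complexNormal
  have hm' : (0 : ℝ) < m := by exact_mod_cast hm
  obtain ⟨hk, hκ⟩ := integral_frameKernel_sq_le hn
  obtain ⟨hU, hU2⟩ := integral_sq_sum_offDiag_le (m := m) measurable_frameKernel frameKernel_comm hk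
    (integral_frameKernel hn)
  obtain ⟨hd, hd1, hd2⟩ := integral_frameKernel_self_le hn
  have hdiag := measureReal_le_sum_eval_le (m := m) hd (t := (m : ℝ) ^ 2 / 16) (by positivity)
    (by nlinarith)
  have hoff := mul_meas_ge_le_integral_of_nonneg (μ := P)
    (Filter.Eventually.of_forall fun a => sq_nonneg _) hU (((m : ℝ) ^ 2 / 8) ^ 2)
  set BU := {a : Fin m → EuclideanSpace ℂ (Fin n) | ((m : ℝ) ^ 2 / 8) ^ 2 ≤
    (∑ p ∈ Finset.univ.offDiag, frameKernel (a p.1) (a p.2)) ^ 2} with hBU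
  set BD := {a : Fin m → EuclideanSpace ℂ (Fin n) | 2 * ((m : ℝ) ^ 2 / 16) ≤
    ∑ i, frameKernel (a i) (a i)} with hBD
  have hsub : {a | (m : ℝ) ^ 2 / 4 < ∑ i, ∑ l, frameKernel (a i) (a l)} ⊆ BU ∪ BD := by
    intro a ha
    have ha' : (m : ℝ) ^ 2 / 4 < ∑ i, ∑ l, frameKernel (a i) (a l) := ha
    rw [sum_sum_eq_sum_add_sum_offDiag] at ha'
    by_cases hD : 2 * ((m : ℝ) ^ 2 / 16) ≤ ∑ i, frameKernel (a i) (a i)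
    · exact Or.inr hD
    · refine Or.inl ?_
      show ((m : ℝ) ^ 2 / 8) ^ 2 ≤ _
      gcongr
      linarith
  refine (measureReal_mono hsub).trans ((measureReal_union_le _ _).trans (add_le_add ?_ ?_))
  · have h1 : ((m : ℝ) ^ 2 / 8) ^ 2 * P.real BU ≤
        2 * m ^ 2 * (4 * n ^ 2 * (K4 + 1) ^ 2) :=
      hoff.trans (hU2.trans (by gcongr))
    rw [le_div_iff₀ (by positivity)]
    have h2 : ((m : ℝ) ^ 2 / 64) * (P.real BU * m ^ 2) ≤
        ((m : ℝ) ^ 2 / 64) * (512 * (K4 + 1) ^ 2 * n ^ 2) := by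
      refine le_trans (le_of_eq ?_) (h1.trans (le_of_eq ?_)) <;> ring
    exact le_of_mul_le_mul_left h2 (by positivity)
  · refine hdiag.trans ?_
    calc _ ≤ m * (2 * n ^ 4 * (K8 + 1)) / ((m : ℝ) ^ 2 / 16) ^ 2 := by gcongr
      _ = _ := by field_simp; ring

theorem measureReal_le_norm_sum_gVec_sub_le (hn : 2 ≤ n) (z x v : EuclideanSpace ℂ (Fin n))
    (hv : ∫ b, gVec z b x ∂(complexNormalVec n) = v) {t : ℝ} (ht : 0 < t) :
    (Measure.pi fun _ : Fin m => complexNormalVec n).real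
      {a | t ≤ ‖∑ i, (gVec z (a i) x - (inner ℂ (a i) v : ℂ) • a i)‖} ≤
      2 * (‖z‖ ^ 2 + ‖v‖ ^ 2) * (∫ w : ℂ, ‖w‖ ^ 4 ∂complexNormal) * n * m / t ^ 2 := by
  set P := Measure.pi fun _ : Fin m => complexNormalVec n
  set K4 := ∫ w : ℂ, ‖w‖ ^ 4 ∂complexNormal
  set G : EuclideanSpace ℂ (Fin n) → EuclideanSpace ℂ (Fin n) :=
    fun b => gVec z b x - (inner ℂ b v : ℂ) • b with hG
  have hGm : Measurable G := (measurable_gVec z x).sub (by fun_prop)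
  have iz := integrable_norm_inner_sq_mul_norm_sq z
  have iv := integrable_norm_inner_sq_mul_norm_sq v
  have hb : ∀ b, ‖G b‖ ^ 2 ≤ 2 * (‖(inner ℂ z b : ℂ)‖ ^ 2 * ‖b‖ ^ 2) +
      2 * (‖(inner ℂ v b : ℂ)‖ ^ 2 * ‖b‖ ^ 2) := by
    intro b
    have h1 : ‖G b‖ ≤ ‖(inner ℂ z b : ℂ)‖ * ‖b‖ + ‖(inner ℂ v b : ℂ)‖ * ‖b‖ := by
      refine (norm_sub_le _ _).trans (add_le_add (norm_gVec_le z b x) ?_)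
      rw [norm_smul, norm_inner_symm]
    have h2 := pow_le_pow_left₀ (norm_nonneg _) h1 2
    nlinarith [sq_nonneg (‖(inner ℂ z b : ℂ)‖ * ‖b‖ - ‖(inner ℂ v b : ℂ)‖ * ‖b‖)]
  have ib := (iz.const_mul 2).add (iv.const_mul 2)
  have hGi : Integrable (fun b => ‖G b‖ ^ 2) (complexNormalVec n) := by
    refine ib.mono' (hGm.norm.pow_const 2).aestronglyMeasurable
      (Filter.Eventually.of_forall fun b => ?_)
    rw [Real.norm_of_nonneg (sq_nonneg _)]
    exact hb b
  have hGL : MemLp G 2 (complexNormalVec n) :=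
    (memLp_two_iff_integrable_sq_norm hGm.aestronglyMeasurable).2 hGi
  have hG0 : ∫ b, G b ∂(complexNormalVec n) = 0 := by
    rw [hG, integral_sub (integrable_gVec z x) (integrable_inner_smul v), integral_inner_smul hn,
      hv, sub_self]
  have hG2 : ∫ b, ‖G b‖ ^ 2 ∂(complexNormalVec n) ≤ 2 * (‖z‖ ^ 2 + ‖v‖ ^ 2) * K4 * n := by
    refine (integral_mono hGi ib hb).trans ?_
    have e : ∫ b : EuclideanSpace ℂ (Fin n), (2 * (‖(inner ℂ z b : ℂ)‖ ^ 2 * ‖b‖ ^ 2) +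
      2 * (‖(inner ℂ v b : ℂ)‖ ^ 2 * ‖b‖ ^ 2)) ∂(complexNormalVec n) =
      2 * ∫ b : EuclideanSpace ℂ (Fin n), ‖(inner ℂ z b : ℂ)‖ ^ 2 * ‖b‖ ^ 2 ∂(complexNormalVec n) +
      2 * ∫ b : EuclideanSpace ℂ (Fin n), ‖(inner ℂ v b : ℂ)‖ ^ 2 * ‖b‖ ^ 2
        ∂(complexNormalVec n) := by
      rw [integral_add (iz.const_mul 2) (iv.const_mul 2), integral_const_mul, integral_const_mul]
    simp only [Pi.add_apply]
    rw [e]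
    have h1 := integral_norm_inner_sq_mul_norm_sq_le hn z
    have h2 := integral_norm_inner_sq_mul_norm_sq_le hn v
    linarith
  obtain ⟨hS, hS2⟩ := integral_norm_sq_sum_eval (m := m) hGL hG0
  have hmk := mul_meas_ge_le_integral_of_nonneg (μ := P)
    (Filter.Eventually.of_forall fun a => sq_nonneg _) hS (t ^ 2)
  rw [hS2] at hmk
  rw [le_div_iff₀ (by positivity), mul_comm]
  refine le_trans ?_ (hmk.trans ((mul_le_mul_of_nonneg_left hG2 (Nat.cast_nonneg m)).trans_eq
    (by ring)))
  exact mul_le_mul_of_nonneg_left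
    (measureReal_mono fun a ha => pow_le_pow_left₀ ht.le ha 2) (sq_nonneg t)

end Concentration

section AngleImprovement

theorem add_arctan_mem_Icc {θ : ℝ} (h0 : 0 < θ) (h1 : θ ≤ Real.pi / 2) (hpos : 0 < h θ) :
    θ ≤ θ + Real.arctan (deriv h θ / h θ) ∧
      θ + Real.arctan (deriv h θ / h θ) ≤ Real.pi / 2 := by
  have hpi := Real.pi_pos
  have hs : 0 < Real.sin θ := Real.sin_pos_of_pos_of_lt_pi h0 (by linarith)
  have hc : 0 ≤ Real.cos θ := Real.cos_nonneg_of_mem_Icc ⟨by linarith, h1⟩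
  have hd := deriv_h_nonneg hs.le hc
  refine ⟨le_add_of_nonneg_right (Real.arctan_nonneg.2 (by positivity)), ?_⟩
  have h2 : deriv h θ / h θ ≤ Real.tan (Real.pi / 2 - θ) := by
    rw [Real.tan_eq_sin_div_cos, Real.sin_pi_div_two_sub, Real.cos_pi_div_two_sub,
      div_le_div_iff₀ hpos hs]
    linarith [deriv_h_mul_sin_le hc]
  have h3 := Real.arctan_strictMono.monotone h2
  rw [Real.arctan_tan (by linarith) (by linarith)] at h3
  linarith

theorem sqrt_mul_sin_add_arctan {θ a b : ℝ} (ha : 0 < a) :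
    √(a ^ 2 + b ^ 2) * Real.sin (θ + Real.arctan (b / a)) =
      a * Real.sin θ + b * Real.cos θ := by
  have h1 : √(a ^ 2 + b ^ 2) = a * √(1 + (b / a) ^ 2) := by
    rw [show a ^ 2 + b ^ 2 = a ^ 2 * (1 + (b / a) ^ 2) by field_simp, Real.sqrt_mul (sq_nonneg a),
      Real.sqrt_sq ha.le]
  have h2 : 0 < √(1 + (b / a) ^ 2) := Real.sqrt_pos.2 (by positivity)
  rw [h1, Real.sin_add, Real.cos_arctan, Real.sin_arctan]
  field_simp

theorem norm_smul_add_smul_of_orthonormal {E : Type*} [NormedAddCommGroup E]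
    [InnerProductSpace ℂ E] {x y : E} (hx : ‖x‖ = 1) (hy : ‖y‖ = 1) (hxy : inner ℂ x y = 0)
    (a b : ℝ) : ‖(a : ℂ) • x + (b : ℂ) • y‖ = √(a ^ 2 + b ^ 2) := by
  have h1 : inner ℂ ((a : ℂ) • x) ((b : ℂ) • y) = 0 := by
    rw [inner_smul_left, inner_smul_right, hxy, mul_zero, mul_zero]
  have h2 := norm_add_sq_eq_norm_sq_add_norm_sq_of_inner_eq_zero _ _ h1
  rw [norm_smul, norm_smul, hx, hy, mul_one, mul_one, Complex.norm_real, Complex.norm_real,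
    Real.norm_eq_abs, Real.norm_eq_abs, abs_mul_abs_self, abs_mul_abs_self] at h2
  rw [← Real.sqrt_mul_self (norm_nonneg ((a : ℂ) • x + (b : ℂ) • y)), h2]
  congr 1
  ring

theorem frame_tail_le {A D C n m : ℝ} (hn : 1 ≤ n) (hm : 0 < m)
    (hC : 2 ≤ C) (hCA : 12288 * A ^ 2 ≤ C) (hCD : 12288 * D ≤ C)
    (hmB : C ^ 2 * n ^ 2 ≤ 4 * m) :
    512 * A ^ 2 * n ^ 2 / m ^ 2 + 512 * D * n ^ 4 / m ^ 3 ≤ 1 / (6 * n) + 1 / (6 * n) := by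
  have hn0 : 0 < n := by linarith
  have hCC : C ≤ C ^ 2 := by nlinarith
  have h4 : 4 * n ^ 2 ≤ 4 * m := le_trans (by gcongr; nlinarith) hmB
  have h5 : n ^ 2 ≤ m := by linarith
  have hnm : n ≤ m := by nlinarith
  refine add_le_add ?_ ?_
  · rw [div_le_div_iff₀ (by positivity) (by positivity), one_mul]
    have h1 : 12288 * A ^ 2 * n ^ 2 ≤ 4 * m := le_trans (by gcongr; linarith) hmB
    have h2 : 12288 * A ^ 2 * n ^ 2 * n ≤ 4 * m * m :=
      mul_le_mul h1 hnm hn0.le (by positivity)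
    linarith
  · rw [div_le_div_iff₀ (by positivity) (by positivity), one_mul]
    have h1 : 12288 * D * n ^ 2 ≤ 4 * m := le_trans (by gcongr; linarith) hmB
    have h2 : 12288 * D * n ^ 2 * n ^ 2 * n ≤ 4 * m * m * m :=
      mul_le_mul (mul_le_mul h1 h5 (by positivity) (by positivity)) hnm hn0.le (by positivity)
    linarith

theorem noise_tail_le {M L κ C n m : ℝ} (hκ : 0 < κ) (hn : 0 < n) (hm : 0 < m)
    (hC : 0 < C) (hML : M ≤ L) (hCL : 1536 * L ≤ κ ^ 2 * C ^ 2) :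
    M * n * m / (m * κ * (C * n / √m) / 16) ^ 2 ≤ 1 / (6 * n) := by
  have e1 : (m * κ * (C * n / √m) / 16) ^ 2 = κ ^ 2 * C ^ 2 * n ^ 2 * m / 256 := by
    rw [div_pow, mul_pow, mul_pow, div_pow, Real.sq_sqrt hm.le]
    field_simp
    norm_num
  rw [e1, div_le_div_iff₀ (by positivity) (by positivity), one_mul]
  calc M * n * m * (6 * n) ≤ L * n * m * (6 * n) := by gcongr
    _ = (1536 * L) * (n ^ 2 * m / 256) := by ring
    _ ≤ (κ ^ 2 * C ^ 2) * (n ^ 2 * m / 256) := by gcongr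
    _ = _ := by ring

theorem sub_lt_theta_of_norm_sub_lt {n : ℕ} {z T v : EuclideanSpace ℂ (Fin n)} {φ κ ε : ℝ}
    (hz : ‖z‖ = 1) (hφ : φ ∈ Set.Icc 0 (Real.pi / 2)) (hκ : 0 < κ) (hε : 0 < ε)
    (hε1 : ε ≤ Real.pi / 2) (hκv : κ ≤ ‖v‖) (hvφ : ‖(inner ℂ z v : ℂ)‖ = ‖v‖ * Real.sin φ)
    (hTv : ‖T - v‖ < κ * ε / 8) : φ - ε < theta z T := by
  have hpi4 := Real.pi_le_four
  have h4 : κ / 2 ≤ ‖T‖ := by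
    have h5 := norm_sub_norm_le v T
    rw [norm_sub_rev] at h5
    nlinarith
  have hT0 : 0 < ‖T‖ := by linarith
  have h6 := sub_theta_le hz hφ (norm_pos_iff.1 (hκ.trans_le hκv)) (norm_pos_iff.1 hT0) hvφ
  have h7 : ‖T - v‖ / ‖T‖ ≤ ε / 4 := by
    rw [div_le_iff₀ hT0]
    nlinarith
  have h8 : Real.pi / 2 * (‖T - v‖ / ‖T‖) ≤ 4 / 2 * (ε / 4) := by gcongr
  linarith

theorem exists_angle_improvement_of_unit :
    ∃ C : ℝ, 0 < C ∧ ∀ n m : ℕ, 2 ≤ n → ∀ x y : EuclideanSpace ℂ (Fin n),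
      ‖x‖ = 1 → ‖y‖ = 1 → inner ℂ x y = 0 → ∀ θ : ℝ, 0 < θ → θ ≤ Real.pi / 2 →
      C * n ≤ θ * √(m : ℝ) →
      ∃ B : Set (Fin m → EuclideanSpace ℂ (Fin n)), MeasurableSet B ∧
        (Measure.pi fun _ : Fin m => complexNormalVec n).real B ≤ 1 / (2 * n) ∧
        ∀ a ∉ B, θ + Real.arctan (deriv h θ / h θ) - C * n / √(m : ℝ) <
          theta ((Real.sin θ : ℂ) • x + (Real.cos θ : ℂ) • y)
            (altMinStep ((Real.sin θ : ℂ) • x + (Real.cos θ : ℂ) • y) a x) := by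
  obtain ⟨κ, hκ, hhκ⟩ := exists_pos_le_h
  set K4 := ∫ w : ℂ, ‖w‖ ^ 4 ∂complexNormal with hK4
  set K8 := ∫ w : ℂ, ‖w‖ ^ 8 ∂complexNormal with hK8
  set S := ∫ p : ℂ × ℂ, ‖p.1‖ * (‖p.1‖ + ‖p.2‖) ∂(complexNormal.prod complexNormal) with hS
  have hK4' : 0 ≤ K4 := integral_nonneg fun _ => by positivity
  have hK8' : 0 ≤ K8 := integral_nonneg fun _ => by positivity
  set L := 2 * (1 + 2 * S ^ 2) * K4 with hL
  have hL' : 0 ≤ L := by positivity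
  obtain ⟨C, hC2, hCL, hCA, hCD, hCm⟩ : ∃ C : ℝ, 2 ≤ C ∧ 1536 * L ≤ κ ^ 2 * C ^ 2 ∧
      12288 * (K4 + 1) ^ 2 ≤ C ∧ 12288 * (K8 + 1) ≤ C ∧ 64 * (K4 + 1) ≤ C := by
    have q1 : 0 ≤ 1536 * L / κ ^ 2 := by positivity
    have q2 : 0 ≤ 12288 * (K4 + 1) ^ 2 := by positivity
    have q3 : 0 ≤ 12288 * (K8 + 1) := by positivity
    have q4 : 0 ≤ 64 * (K4 + 1) := by positivity
    refine ⟨2 + 1536 * L / κ ^ 2 + 12288 * (K4 + 1) ^ 2 + 12288 * (K8 + 1) + 64 * (K4 + 1),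
      by linarith, ?_, by linarith, by linarith, by linarith⟩
    generalize hR : 2 + 1536 * L / κ ^ 2 + 12288 * (K4 + 1) ^ 2 + 12288 * (K8 + 1) +
      64 * (K4 + 1) = R
    have h1 : 2 ≤ R := by linarith
    have h2 : 1536 * L / κ ^ 2 ≤ R ^ 2 := by
      have : 1536 * L / κ ^ 2 ≤ R := by linarith
      nlinarith
    rwa [div_le_iff₀ (by positivity), mul_comm (R ^ 2)] at h2
  refine ⟨C, by linarith, fun n m hn x y hx hy hxy θ hθ0 hθ1 hmain => ?_⟩
  set z := (Real.sin θ : ℂ) • x + (Real.cos θ : ℂ) • y with hz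
  set v := (h θ : ℂ) • x + ((deriv h θ : ℝ) : ℂ) • y with hv
  set φ := θ + Real.arctan (deriv h θ / h θ) with hφ
  have hpi := Real.pi_pos
  have hpi4 := Real.pi_le_four
  have hs : 0 < Real.sin θ := Real.sin_pos_of_pos_of_lt_pi hθ0 (by linarith)
  have hc : 0 ≤ Real.cos θ := Real.cos_nonneg_of_mem_Icc ⟨by linarith, hθ1⟩
  have hκh := hhκ θ hs.le hc
  have hpos : 0 < h θ := hκ.trans_le hκh
  have hd := deriv_h_nonneg hs.le hc
  obtain ⟨hθφ, hφ1⟩ := add_arctan_mem_Icc hθ0 hθ1 hpos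
  have hn1 : (1 : ℝ) ≤ n := by exact_mod_cast (by omega : 1 ≤ n)
  have hn0 : (0 : ℝ) < n := by linarith
  have hsm : 0 < √(m : ℝ) := by
    by_contra hcon
    have : √(m : ℝ) = 0 := le_antisymm (not_lt.1 hcon) (Real.sqrt_nonneg _)
    rw [this, mul_zero] at hmain
    nlinarith
  have hm0 : (0 : ℝ) < m := Real.sqrt_pos.1 hsm
  have hm0' : 0 < m := by exact_mod_cast hm0
  have hsq : √(m : ℝ) ^ 2 = m := Real.sq_sqrt hm0.le
  have hmB : C ^ 2 * (n : ℝ) ^ 2 ≤ 4 * m := by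
    have h1 : C * n ≤ 2 * √(m : ℝ) := hmain.trans (by gcongr; linarith)
    have h2 := pow_le_pow_left₀ (by positivity) h1 2
    rw [mul_pow, mul_pow, hsq] at h2
    linarith
  have hCC : C ≤ C ^ 2 := by nlinarith
  have hmK : 16 * (K4 + 1) * (n : ℝ) ^ 2 ≤ m := by
    have h1 := mul_le_mul_of_nonneg_right (hCm.trans hCC) (sq_nonneg (n : ℝ))
    linarith
  have hz1 : ‖z‖ = 1 := by
    rw [hz, norm_smul_add_smul_of_orthonormal hx hy hxy, Real.sin_sq_add_cos_sq, Real.sqrt_one]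
  have hvn : ‖v‖ = √(h θ ^ 2 + deriv h θ ^ 2) := norm_smul_add_smul_of_orthonormal hx hy hxy _ _
  have hκv : κ ≤ ‖v‖ := by
    rw [hvn]
    exact hκh.trans (Real.le_sqrt_of_sq_le (by nlinarith [sq_nonneg (deriv h θ)]))
  have hvS : ‖v‖ ^ 2 ≤ 2 * S ^ 2 := by
    rw [hvn, Real.sq_sqrt (by positivity)]
    have h1 := pow_le_pow_left₀ (abs_nonneg _) (abs_h_le θ) 2
    have h2 := pow_le_pow_left₀ (abs_nonneg _) (abs_deriv_h_le θ) 2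
    rw [sq_abs] at h1 h2
    linarith
  have hv0 : v ≠ 0 := norm_pos_iff.1 (hκ.trans_le hκv)
  have hzv : ‖(inner ℂ z v : ℂ)‖ = ‖v‖ * Real.sin φ := by
    have hxx : inner ℂ x x = (1 : ℂ) := by rw [inner_self_eq_norm_sq_to_K, hx]; simp
    have hyy : inner ℂ y y = (1 : ℂ) := by rw [inner_self_eq_norm_sq_to_K, hy]; simp
    have hyx : inner ℂ y x = 0 := inner_eq_zero_symm.1 hxy
    have h1 : inner ℂ z v =
        ((h θ * Real.sin θ + deriv h θ * Real.cos θ : ℝ) : ℂ) := by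
      rw [hz, hv]
      simp only [inner_add_left, inner_add_right, inner_smul_left, inner_smul_right, hxx, hyy, hxy,
        hyx, Complex.conj_ofReal]
      push_cast
      ring
    rw [h1, Complex.norm_real, Real.norm_of_nonneg (by positivity), hvn, hφ,
      sqrt_mul_sin_add_arctan hpos]
  set ε := C * n / √(m : ℝ) with hε
  have hε0 : 0 < ε := by positivity
  have hεθ : ε ≤ θ := by rw [hε, div_le_iff₀ hsm]; exact hmain
  set t := m * κ * ε / 16 with ht
  have ht0 : 0 < t := by positivity
  set B1 := {a : Fin m → EuclideanSpace ℂ (Fin n) |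
    (m : ℝ) ^ 2 / 4 < ∑ i, ∑ l, frameKernel (a i) (a l)} with hB1
  set B2 := {a : Fin m → EuclideanSpace ℂ (Fin n) |
    t ≤ ‖∑ i, (gVec z (a i) x - (inner ℂ (a i) v : ℂ) • a i)‖} with hB2
  have hk : ∀ i l : Fin m, Measurable fun a : Fin m → EuclideanSpace ℂ (Fin n) =>
      frameKernel (a i) (a l) := fun i l =>
    measurable_frameKernel.comp (f := fun a : Fin m → EuclideanSpace ℂ (Fin n) => (a i, a l))
      (by fun_prop)
  have hg : ∀ i : Fin m, Measurable fun a : Fin m → EuclideanSpace ℂ (Fin n) =>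
      gVec z (a i) x - (inner ℂ (a i) v : ℂ) • a i := fun i =>
    ((measurable_gVec z x).comp (measurable_pi_apply i)).sub (by fun_prop)
  refine ⟨B1 ∪ B2, ?_, ?_, ?_⟩
  · refine MeasurableSet.union (measurableSet_lt measurable_const ?_)
      (measurableSet_le measurable_const ?_)
    · exact Finset.measurable_sum _ fun i _ => Finset.measurable_sum _ fun l _ => hk i l
    · exact (Finset.measurable_sum _ fun i _ => hg i).norm
  · have p1 := measureReal_frame_not_tight_le hn hm0' hmK
    have p2 := measureReal_le_norm_sum_gVec_sub_le (m := m) hn z x v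
      (integral_gVec hn hx hy hxy θ) ht0
    have r12 := frame_tail_le (A := K4 + 1) (D := K8 + 1) hn1 hm0
      hC2 hCA hCD hmB
    have e2 : 2 * (‖z‖ ^ 2 + ‖v‖ ^ 2) * K4 ≤ L := by
      rw [hL, hz1]
      gcongr
      linarith
    have r3 := noise_tail_le hκ hn0 hm0 (by linarith) e2 hCL
    refine (measureReal_union_le _ _).trans ?_
    have e : 1 / (2 * (n : ℝ)) = 1 / (6 * n) + 1 / (6 * n) + 1 / (6 * n) := by
      field_simp; norm_num
    rw [e]
    exact add_le_add (p1.trans r12) (p2.trans r3)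
  · intro a ha
    have ha1 : ∑ i, ∑ l, frameKernel (a i) (a l) ≤ (m : ℝ) ^ 2 / 4 :=
      not_lt.1 fun hcon => ha (Or.inl hcon)
    have ha2 : ‖∑ i, (gVec z (a i) x - (inner ℂ (a i) v : ℂ) • a i)‖ < t :=
      not_le.1 fun hcon => ha (Or.inr hcon)
    set T := altMinStep z a x with hTdef
    have h1 : ‖T - v‖ < κ * ε / 8 := by
      have h2 := (norm_altMinStep_sub_le hm0' ha1 z x v).trans_lt ha2
      rw [← hTdef] at h2
      have h3 : (m : ℝ) / 2 * ‖T - v‖ < m / 2 * (κ * ε / 8) := by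
        refine h2.trans_eq ?_
        rw [ht]; ring
      exact lt_of_mul_lt_mul_left h3 (by positivity)
    exact sub_lt_theta_of_norm_sub_lt hz1 ⟨by linarith, hφ1⟩ hκ hε0 (hεθ.trans hθ1) hκv hzv h1

theorem gVec_smul_smul {n : ℕ} (z x b : EuclideanSpace ℂ (Fin n)) (c : ℂ) {r : ℝ} (hr : 0 < r) :
    gVec (c • z) b ((r : ℂ) • x) = (‖c‖ : ℂ) • gVec z b x := by
  simp only [gVec, inner_smul_right, norm_mul, Complex.norm_real, Real.norm_of_nonneg hr.le]
  rw [smul_smul, ← mul_assoc, ← mul_assoc, ← Complex.ofReal_mul, ← Complex.ofReal_mul]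
  congr 3
  field_simp

theorem altMinStep_smul_smul {n m : ℕ} (z x : EuclideanSpace ℂ (Fin n))
    (a : Fin m → EuclideanSpace ℂ (Fin n)) (c : ℂ) {r : ℝ} (hr : 0 < r) :
    altMinStep (c • z) a ((r : ℂ) • x) = (‖c‖ : ℂ) • altMinStep z a x := by
  simp only [altMinStep, gVec_smul_smul z x _ c hr, ← Finset.smul_sum]
  rw [WithLp.ofLp_smul, Matrix.mulVec_smul, WithLp.toLp_smul]

theorem theta_smul_smul {n : ℕ} (z x : EuclideanSpace ℂ (Fin n)) {c d : ℂ} (hc : c ≠ 0)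
    (hd : d ≠ 0) : theta (c • z) (d • x) = theta z x := by
  have hc' := norm_pos_iff.2 hc
  have hd' := norm_pos_iff.2 hd
  rw [theta, theta, inner_smul_left, inner_smul_right, norm_smul, norm_smul, norm_mul, norm_mul,
    RCLike.norm_conj]
  congr 1
  rw [show ‖d‖ * (‖c‖ * ‖(inner ℂ x z : ℂ)‖) = (‖d‖ * ‖c‖) * ‖(inner ℂ x z : ℂ)‖ by ring,
    show ‖d‖ * ‖x‖ * (‖c‖ * ‖z‖) = (‖d‖ * ‖c‖) * (‖x‖ * ‖z‖) by ring,
    mul_div_mul_left _ _ (by positivity)]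

theorem exists_orthonormal_decomposition {n : ℕ} (hn : 2 ≤ n) {z x : EuclideanSpace ℂ (Fin n)}
    (hxz : inner ℂ x z ≠ 0) :
    ∃ (c : ℂ) (r : ℝ) (e f : EuclideanSpace ℂ (Fin n)), c ≠ 0 ∧ 0 < r ∧ ‖e‖ = 1 ∧ ‖f‖ = 1 ∧
      inner ℂ e f = 0 ∧ x = (r : ℂ) • e ∧
      z = c • ((Real.sin (theta z x) : ℂ) • e + (Real.cos (theta z x) : ℂ) • f) := by
  have hx : x ≠ 0 := fun h0 => hxz (by rw [h0, inner_zero_left])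
  have hz : z ≠ 0 := fun h0 => hxz (by rw [h0, inner_zero_right])
  have hx' := norm_pos_iff.2 hx
  have hz' := norm_pos_iff.2 hz
  have hi' := norm_pos_iff.2 hxz
  set w : ℂ := inner ℂ x z with hw
  have hsin : Real.sin (theta z x) = ‖w‖ / (‖x‖ * ‖z‖) := by
    rw [theta, Real.sin_arcsin]
    · have : 0 ≤ ‖w‖ / (‖x‖ * ‖z‖) := by positivity
      linarith
    · exact div_le_one_of_le₀ (norm_inner_le_norm x z) (by positivity)
  have hcos0 : 0 ≤ Real.cos (theta z x) := Real.cos_arcsin_nonneg _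
  have hsc := Real.sin_sq_add_cos_sq (theta z x)
  set s := Real.sin (theta z x)
  set k := Real.cos (theta z x)
  set e : EuclideanSpace ℂ (Fin n) := ((‖x‖⁻¹ : ℝ) : ℂ) • x with he
  have he1 : ‖e‖ = 1 := by
    rw [he, norm_smul, Complex.norm_real, norm_inv, norm_norm, inv_mul_cancel₀ hx'.ne']
  have hxe : x = (‖x‖ : ℂ) • e := by
    rw [he, smul_smul, ← Complex.ofReal_mul, mul_inv_cancel₀ hx'.ne', Complex.ofReal_one, one_smul]
  have hwn : (‖w‖ : ℂ) ≠ 0 := by exact_mod_cast hi'.ne'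
  have hzn : (‖z‖ : ℂ) ≠ 0 := by exact_mod_cast hz'.ne'
  have hxn : (‖x‖ : ℂ) ≠ 0 := by exact_mod_cast hx'.ne'
  set c : ℂ := w / ‖w‖ * ‖z‖ with hc
  have hc0 : c ≠ 0 := mul_ne_zero (div_ne_zero hxz hwn) hzn
  have hcn : ‖c‖ = ‖z‖ := by
    rw [hc, norm_mul, norm_div, Complex.norm_real, Complex.norm_real, norm_norm, norm_norm,
      div_self hi'.ne', one_mul]
  set z0 := c⁻¹ • z with hz0
  have hz01 : ‖z0‖ = 1 := by rw [hz0, norm_smul, norm_inv, hcn, inv_mul_cancel₀ hz'.ne']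
  have hzc : z = c • z0 := by rw [hz0, smul_smul, mul_inv_cancel₀ hc0, one_smul]
  have hez : inner ℂ e z0 = (s : ℂ) := by
    rw [he, hz0, inner_smul_left, inner_smul_right, Complex.conj_ofReal, ← hw, hsin, hc]
    push_cast
    field_simp
  clear_value e z0
  have hee : inner ℂ e e = (1 : ℂ) := by rw [inner_self_eq_norm_sq_to_K, he1]; simp
  have hed : inner ℂ e (z0 - (s : ℂ) • e) = 0 := by
    rw [inner_sub_right, inner_smul_right, hez, hee, mul_one, sub_self]
  have hdn : ‖z0 - (s : ℂ) • e‖ = k := by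
    have h1 := norm_sq_eq_norm_inner_sq_add he1 z0
    rw [hez, hz01, Complex.norm_real, Real.norm_eq_abs, sq_abs] at h1
    exact (sq_eq_sq₀ (norm_nonneg _) hcos0).1 (by linarith)
  suffices hf : ∃ f : EuclideanSpace ℂ (Fin n), ‖f‖ = 1 ∧ inner ℂ e f = 0 ∧
      z0 = (s : ℂ) • e + (k : ℂ) • f by
    obtain ⟨f, hf1, hf2, hf3⟩ := hf
    exact ⟨c, ‖x‖, e, f, hc0, hx', he1, hf1, hf2, hxe, by rw [← hf3]; exact hzc⟩
  rcases hcos0.eq_or_lt with hk | hk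
  · obtain ⟨b, hb⟩ := exists_orthonormalBasis_single hn he1
    refine ⟨b ⟨1, by omega⟩, b.orthonormal.1 _, ?_, ?_⟩
    · rw [← hb]
      exact b.orthonormal.2 (by simp)
    · rw [← hk] at hdn ⊢
      rw [Complex.ofReal_zero, zero_smul, add_zero]
      exact sub_eq_zero.1 (norm_eq_zero.1 hdn)
  · have hk' : (k : ℂ) ≠ 0 := by exact_mod_cast hk.ne'
    refine ⟨(k : ℂ)⁻¹ • (z0 - (s : ℂ) • e), ?_, ?_, ?_⟩
    · rw [norm_smul, hdn, norm_inv, Complex.norm_real, Real.norm_of_nonneg hk.le,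
        inv_mul_cancel₀ hk.ne']
    · rw [inner_smul_right, hed, mul_zero]
    · rw [smul_smul, mul_inv_cancel₀ hk', one_smul, add_sub_cancel]

theorem half_inv_le_two_div_log_sq {n : ℕ} (hn : 2 ≤ n) :
    1 / (2 * (n : ℝ)) ≤ 2 / Real.log (n : ℝ) ^ 2 := by
  have hn1 : (1 : ℝ) < n := by exact_mod_cast (by omega : 1 < n)
  have hl := Real.log_pos hn1
  have hs : 0 < √(n : ℝ) := Real.sqrt_pos.2 (by linarith)
  have h1 := Real.log_le_sub_one_of_pos hs
  rw [Real.log_sqrt (by linarith)] at h1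
  have h2 := pow_le_pow_left₀ hl.le (by linarith : Real.log n ≤ 2 * √(n : ℝ)) 2
  rw [mul_pow, Real.sq_sqrt (by linarith)] at h2
  rw [div_le_div_iff₀ (by positivity) (by positivity)]
  linarith

end AngleImprovement

end PhaseRetrieval

open PhaseRetrieval in
theorem theorem2 :
    ∃ C₃ C₄ : ℝ, 0 < C₃ ∧ 0 < C₄ ∧
      ∀ n m : ℕ, 2 ≤ n → C₃ * (n : ℝ) < (m : ℝ) → C₃ * Real.log (m : ℝ) < (n : ℝ) →
        ∀ (Ω : Type*) (_ : MeasurableSpace Ω) (P : MeasureTheory.Measure Ω)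
          (_ : MeasureTheory.IsProbabilityMeasure P)
          (a : Fin m → Ω → EuclideanSpace ℂ (Fin n)),
          (∀ i, ProbabilityTheory.HasLaw (a i) (PhaseRetrieval.complexNormalVec n) P) →
          ProbabilityTheory.iIndepFun a P →
          ∀ z x : EuclideanSpace ℂ (Fin n), inner ℂ x z ≠ 0 →
            1 - 2 / Real.log (n : ℝ) ^ 2 ≤
              P.real {ω |
                PhaseRetrieval.theta z (PhaseRetrieval.altMinStep z (fun i => a i ω) x) >
                  (1 - C₄ * ((n : ℝ) / (PhaseRetrieval.theta z x * √(m : ℝ)))) *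
                    (PhaseRetrieval.theta z x +
                      Real.arctan (deriv PhaseRetrieval.h (PhaseRetrieval.theta z x) /
                        PhaseRetrieval.h (PhaseRetrieval.theta z x)))} := by
  obtain ⟨C, hC, hmain⟩ := exists_angle_improvement_of_unit
  obtain ⟨κ, hκ, hhκ⟩ := exists_pos_le_h
  refine ⟨1, C, one_pos, hC, fun n m hn hnm _ Ω _ P _ a hlaw hind z x hxz => ?_⟩
  have hn0 : (0 : ℝ) < n := by exact_mod_cast (by omega : 0 < n)
  have hm0 : (0 : ℝ) < m := by linarith
  have hsm : 0 < √(m : ℝ) := Real.sqrt_pos.2 hm0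
  obtain ⟨c, r, e, f, hc, hr, he, hf, hef, hxe, hzc⟩ := exists_orthonormal_decomposition hn hxz
  set θ := theta z x with hθ
  have hx : x ≠ 0 := fun h0 => hxz (by rw [h0, inner_zero_left])
  have hz : z ≠ 0 := fun h0 => hxz (by rw [h0, inner_zero_right])
  have hθ0 : 0 < θ := by
    have := norm_pos_iff.2 hx
    have := norm_pos_iff.2 hz
    have := norm_pos_iff.2 hxz
    exact Real.arcsin_pos.2 (by positivity)
  have hθ1 : θ ≤ Real.pi / 2 := Real.arcsin_le_pi_div_two _
  have hs : 0 < Real.sin θ := Real.sin_pos_of_pos_of_lt_pi hθ0 (by linarith [Real.pi_pos])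
  have hcos : 0 ≤ Real.cos θ := Real.cos_nonneg_of_mem_Icc ⟨by linarith [Real.pi_pos], hθ1⟩
  obtain ⟨hθφ, hφ1⟩ := add_arctan_mem_Icc hθ0 hθ1 (hκ.trans_le (hhκ θ hs.le hcos))
  set φ := θ + Real.arctan (deriv h θ / h θ)
  have hlog := half_inv_le_two_div_log_sq hn
  by_cases hbig : C * n ≤ θ * √(m : ℝ)
  · obtain ⟨B, hBm, hBP, hB⟩ := hmain n m hn e f he hf hef θ hθ0 hθ1 hbig
    have haem : ∀ i, AEMeasurable (a i) P := fun i => (hlaw i).aemeasurable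
    set A : Ω → Fin m → EuclideanSpace ℂ (Fin n) := fun ω i => a i ω
    have hA : AEMeasurable A P := aemeasurable_pi_lambda _ haem
    have hmap : P.map A = Measure.pi fun _ => complexNormalVec n := by
      rw [(iIndepFun_iff_map_fun_eq_pi_map haem).1 hind]
      congr 1
      funext i
      exact (hlaw i).map_eq
    have hreal : P.real (A ⁻¹' Bᶜ) = 1 - (Measure.pi fun _ => complexNormalVec n).real B := by
      rw [measureReal_def, ← Measure.map_apply_of_aemeasurable hA hBm.compl, hmap,
        ← measureReal_def, probReal_compl_eq_one_sub hBm]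
    refine le_trans (by rw [hreal]; linarith) (measureReal_mono (s₁ := A ⁻¹' Bᶜ) fun ω hω => ?_)
    have h1 := hB (A ω) hω
    have h2 : theta z (altMinStep z (A ω) x) =
        theta ((Real.sin θ : ℂ) • e + (Real.cos θ : ℂ) • f)
          (altMinStep ((Real.sin θ : ℂ) • e + (Real.cos θ : ℂ) • f) (A ω) e) := by
      conv_lhs => rw [hxe, hzc]
      rw [altMinStep_smul_smul _ _ _ _ hr, theta_smul_smul _ _ hc
        (by exact_mod_cast (norm_pos_iff.2 hc).ne')]
    show (1 - C * ((n : ℝ) / (θ * √(m : ℝ)))) * φ < theta z (altMinStep z (A ω) x)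
    rw [h2]
    refine lt_of_le_of_lt ?_ h1
    have h3 : C * ((n : ℝ) / (θ * √(m : ℝ))) * φ = C * n / √(m : ℝ) * (φ / θ) := by
      field_simp
    have h4 : 1 ≤ φ / θ := (one_le_div hθ0).2 hθφ
    have h5 : 0 < C * n / √(m : ℝ) := by positivity
    nlinarith
  · have huniv : {ω | theta z (altMinStep z (fun i => a i ω) x) >
        (1 - C * ((n : ℝ) / (θ * √(m : ℝ)))) * φ} = Set.univ := by
      refine Set.eq_univ_of_forall fun ω => ?_
      have h1 : 1 < C * ((n : ℝ) / (θ * √(m : ℝ))) := by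
        rw [← mul_div_assoc, one_lt_div (by positivity)]
        exact not_le.1 hbig
      have h2 : 0 ≤ theta z (altMinStep z (fun i => a i ω) x) :=
        Real.arcsin_nonneg.2 (by positivity)
      have h3 : (1 - C * ((n : ℝ) / (θ * √(m : ℝ)))) * φ < 0 :=
        mul_neg_of_neg_of_pos (by linarith) (by linarith)
      exact h3.trans_le h2
    rw [huniv, probReal_univ]
    have : 0 ≤ 2 / Real.log (n : ℝ) ^ 2 := by positivity
    linarith
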